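/- Let $H$ be a finitely generated abelian group, $\mathrm{Hom}(H;\mathbb{R})$ the real vector space of its real characters and $\mathrm{S}(H)=(\mathrm{Hom}(H;\mathbb{R})\setminus\{0\})/\mathbb{R}_{>0}$ its character sphere; for $Z\subseteq\mathrm{Hom}(H;\mathbb{R})$ let $\mathrm{S}(Z)\subseteq\mathrm{S}(H)$ be the image of $Z\setminus\{0\}$. *Tropical variety over a ring.* For a commutative ring $R$, $\chi\in\mathrm{Hom}(H;\mathbb{R})$ and $f=\sum a_h h\in RH$, let the initial form $\mathrm{in}_\chi(f)$ be the sum of the terms $a_h h$ with $a_h\neq 0$ for which $\chi(h)$ is minimal. For an ideal $I\subseteq RH$ let $\mathrm{in}_\chi(I)$ be the ideal generated by all $\mathrm{in}_\chi(f)$ with $f\in I$, and put $\mathrm{Trop}_R(I)=\{\chi\in\mathrm{Hom}(H;\mathbb{R})\mid \mathrm{in}_\chi(I)\neq RH\}$. *Tropical variety over a valued field.* Let $\Bbbk$ be a field with a (possibly trivial) valuation $v\colon\Bbbk\to\mathbb{R}\cup\{\infty\}$. For an ideal $J\subseteq\Bbbk\mathbb{Z}^n=\Bbbk[x_1^{\pm1},\dots,x_n^{\pm1}]$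 let $\mathrm{Trop}_{\Bbbk,v}(J)$ be the set of $w\in\mathrm{Hom}(\mathbb{Z}^n;\mathbb{R})=\mathbb{R}^n$ such that for every nonzero $f=\sum a_u x^u\in J$ the minimum $\min\{v(a_u)+w(u)\mid a_u\neq 0\}$ is attained for at least two $u$. For an ideal $J\subseteq\Bbbk H$ choose an epimorphism $\psi\colon\mathbb{Z}^n\to H$, let $\tilde J\subseteq\Bbbk\mathbb{Z}^n$ be the preimage of $J$, and put $\mathrm{Trop}_{\Bbbk,v}(J)=\{\chi\in\mathrm{Hom}(H;\mathbb{R})\mid\chi\circ\psi\in\mathrm{Trop}_{\Bbbk,v}(\tilde J)\}$; this does not depend on $\psi$. For an ideal $I\subseteq\mathbb{Z}H$ and a field $\Bbbk$, write $I\otimes\Bbbk$ for the ideal of $\Bbbk H$ generated by the image of $I$. Let $v_0$ be the trivial valuation on $\mathbb{Q}$, $v_p$ the $p$-adic valuation on $\mathbb{Q}$, and $\hat v_p$ the trivial valuation on $\mathbb{F}_p$. **Proposition.** For every ideal $I\subseteq\mathbb{Z}H$, $$\mathrm{S}\big(\mathrm{Trop}_{\mathbb{Z}}(I)\big)=\mathrm{S}\Big(\mathrm{Trop}_{\mathbb{Q},v_0}(I\otimes\mathbb{Q})\cup\bigcup_{p\in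 P}\big(\mathrm{Trop}_{\mathbb{Q},v_p}(I\otimes\mathbb{Q})\cup\mathrm{Trop}_{\mathbb{F}_p,\hat v_p}(I\otimes\mathbb{F}_p)\big)\Big)$$ holds when $P$ is the set of all primes, and it also holds for some finite set $P$ of primes (depending on $I$). -/

import Mathlib

noncomputable section

open Classical

/-! ### The character sphere -/

/-- The sphere `S(H) = (Hom(H, ℝ) - {0}) / ℝ⁺` of an (additively written) abelian group `H`;
`Module.Ray ℝ V` is the quotient of the nonzero vectors of `V` by positive scalings. -/
abbrev CharSphere (H : Type*) [AddCommGroup H] : Type _ := Module.Ray ℝ (H →+ ℝ)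

/-- `S(Z)`: the image of `Z - {0}` in `S(H)`. -/
def sphereProj {H : Type*} [AddCommGroup H] (Z : Set (H →+ ℝ)) : Set (CharSphere H) :=
  {r | ∃ (χ : H →+ ℝ) (hχ : χ ≠ 0), χ ∈ Z ∧ rayOfNeZero ℝ χ hχ = r}

/-! ### The tropical variety over a ring -/

section Ring

variable {R : Type*} [CommRing R] {H : Type*} [AddCommGroup H]

/-- The initial form `in_χ(f)`: the sum of all terms `a_h h` of `f` (with `a_h ≠ 0`) for which
`χ h` is minimal, i.e. equal to the `χ`-degree of `f`. -/
def initialForm (χ : H →+ ℝ) (f : AddMonoidAlgebra R H) : AddMonoidAlgebra R H :=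
  AddMonoidAlgebra.ofCoeff (f.coeff.filter fun h => ∀ g ∈ f.coeff.support, χ h ≤ χ g)

/-- The initial ideal `in_χ(I)`, generated by the initial forms of the elements of `I`. -/
def initialIdeal (χ : H →+ ℝ) (I : Ideal (AddMonoidAlgebra R H)) : Ideal (AddMonoidAlgebra R H) :=
  Ideal.span (initialForm χ '' (I : Set (AddMonoidAlgebra R H)))

/-- The tropical variety `Trop_R(I)` over the ring `R`. -/
def tropRing (I : Ideal (AddMonoidAlgebra R H)) : Set (H →+ ℝ) :=
  {χ | initialIdeal χ I ≠ ⊤}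

end Ring

/-! ### The tropical variety over a valued field -/

section Field

variable {k : Type*} [Field k] (v : AddValuation k (WithTop ℝ))

/-- The term `v(a_u) + w(u)` of the tropical polynomial of `f = ∑ a_u x^u`. -/
def tropTerm {G : Type*} [AddCommGroup G] (f : AddMonoidAlgebra k G) (w : G →+ ℝ) (u : G) :
    WithTop ℝ :=
  v (f.coeff u) + (w u : WithTop ℝ)

/-- The tropical polynomial `w ↦ min {v(a_u) + w(u) | a_u ≠ 0}` of `f = ∑ a_u x^u`. -/
def tropPoly {G : Type*} [AddCommGroup G] (f : AddMonoidAlgebra k G) (w : G →+ ℝ) : WithTop ℝ :=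
  f.coeff.support.inf (tropTerm v f w)

/-- The tropical hypersurface of `f`: the minimum in the tropical polynomial is achieved at
least twice. -/
def tropHypersurface {G : Type*} [AddCommGroup G] (f : AddMonoidAlgebra k G) : Set (G →+ ℝ) :=
  {w | ∃ u ∈ f.coeff.support, ∃ u' ∈ f.coeff.support, u ≠ u' ∧
    tropTerm v f w u = tropPoly v f w ∧ tropTerm v f w u' = tropPoly v f w}

/-- The tropical variety of an ideal of the Laurent polynomial ring `k[ℤⁿ]`, as a subset of
`Hom(ℤⁿ, ℝ) = ℝⁿ`. -/
def tropLaurent {n : ℕ} (I : Ideal (AddMonoidAlgebra k (Fin n → ℤ))) :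
    Set ((Fin n → ℤ) →+ ℝ) :=
  {w | ∀ f ∈ I, f ≠ 0 → w ∈ tropHypersurface v f}

variable {H : Type*} [AddCommGroup H]

/-- For a homomorphism `ψ : ℤⁿ → H`, the preimage in `k[ℤⁿ]` of an ideal of `k[H]`. -/
def liftIdeal {n : ℕ} (ψ : (Fin n → ℤ) →+ H) (I : Ideal (AddMonoidAlgebra k H)) :
    Ideal (AddMonoidAlgebra k (Fin n → ℤ)) :=
  I.comap (AddMonoidAlgebra.mapDomainRingHom k ψ)

/-- The tropical variety `Trop_{k,v}(I) ⊆ Hom(H, ℝ)` of an ideal `I` of `k[H]`, for a finitely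
generated abelian group `H`: a character `χ` belongs to it if `ψ^*χ` belongs to the tropical
variety of the preimage of `I` in `k[ℤⁿ]`, where `ψ : ℤⁿ → H` is an epimorphism.
This does not depend on `ψ`: see `tropField_eq`. -/
def tropField (I : Ideal (AddMonoidAlgebra k H)) : Set (H →+ ℝ) :=
  {χ | ∀ (n : ℕ) (ψ : (Fin n → ℤ) →+ H), Function.Surjective ψ →
    χ.comp ψ ∈ tropLaurent v (liftIdeal ψ I)}

theorem tropTerm_ne_top {G : Type*} [AddCommGroup G] (f : AddMonoidAlgebra k G) (w : G →+ ℝ)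
    {u : G} (hu : u ∈ f.coeff.support) : tropTerm v f w u ≠ ⊤ := by
  unfold tropTerm
  rw [Ne, WithTop.add_eq_top, not_or]
  refine ⟨?_, WithTop.coe_ne_top⟩
  rw [AddValuation.top_iff]
  exact Finsupp.mem_support_iff.mp hu

theorem comp_mem_tropLaurent_iff {n : ℕ} (ψ : (Fin n → ℤ) →+ H) (hψ : Function.Surjective ψ)
    (I : Ideal (AddMonoidAlgebra k H)) (χ : H →+ ℝ) :
    χ.comp ψ ∈ tropLaurent v (liftIdeal ψ I) ↔
      ∀ f ∈ I, f ≠ 0 → χ ∈ tropHypersurface v f := by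
  constructor
  · intro hw f hf hf0
    obtain ⟨s, hs⟩ := hψ.hasRightInverse
    have hsi : Function.Injective s := hs.injective
    set F : AddMonoidAlgebra k (Fin n → ℤ) :=
      AddMonoidAlgebra.ofCoeff (f.coeff.mapDomain s) with hF
    have hFs : F.coeff.support = f.coeff.support.image s := by
      rw [hF]; exact Finsupp.mapDomain_support_of_injective hsi _
    have hFt : ∀ h, tropTerm v F (χ.comp ψ) (s h) = tropTerm v f χ h := by
      intro h
      have h1 : F.coeff (s h) = f.coeff h := by
        rw [hF]; exact Finsupp.mapDomain_apply hsi _ _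
      simp only [tropTerm, h1, AddMonoidHom.comp_apply, hs h]
    have hFp : tropPoly v F (χ.comp ψ) = tropPoly v f χ := by
      unfold tropPoly
      rw [hFs, Finset.inf_image]
      exact Finset.inf_congr rfl fun h _ => hFt h
    have hmap : AddMonoidAlgebra.mapDomainRingHom k ψ F = f := by
      apply AddMonoidAlgebra.coeff_injective
      change Finsupp.mapDomain ψ (Finsupp.mapDomain s f.coeff) = f.coeff
      rw [← Finsupp.mapDomain_comp, hs.comp_eq_id, Finsupp.mapDomain_id]
    have hFI : F ∈ liftIdeal ψ I := by
      rw [liftIdeal, Ideal.mem_comap, hmap]; exact hf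
    have hF0 : F ≠ 0 := by
      intro h0
      rw [h0, map_zero] at hmap
      exact hf0 hmap.symm
    obtain ⟨u, hu, u', hu', hne, h1, h2⟩ := hw F hFI hF0
    rw [hFs, Finset.mem_image] at hu hu'
    obtain ⟨h, hh, rfl⟩ := hu
    obtain ⟨h', hh', rfl⟩ := hu'
    rw [hFt, hFp] at h1 h2
    exact ⟨h, hh, h', hh', fun e => hne (congrArg s e), h1, h2⟩
  · intro hD F hF hF0
    by_contra hcon
    set w := χ.comp ψ with hw
    have hne : F.coeff.support.Nonempty := by
      rw [Finsupp.support_nonempty_iff]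
      exact fun h => hF0 (AddMonoidAlgebra.coeff_injective h)
    obtain ⟨u, hu, hmin⟩ := Finset.exists_mem_eq_inf F.coeff.support hne (tropTerm v F w)
    have hlt : ∀ u' ∈ F.coeff.support, u' ≠ u → tropTerm v F w u < tropTerm v F w u' := by
      intro u' hu' hn
      refine lt_of_le_of_ne (hmin ▸ Finset.inf_le hu') fun he => hcon ?_
      exact ⟨u, hu, u', hu', hn.symm, hmin.symm, (he ▸ hmin).symm⟩
    set f := AddMonoidAlgebra.mapDomainRingHom k ψ F with hf
    have hfc : ∀ h, f.coeff h = ∑ u' ∈ F.coeff.support with ψ u' = h, F.coeff u' := by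
      intro h
      change (Finsupp.mapDomain ψ F.coeff) h = _
      rw [Finsupp.mapDomain, Finsupp.sum_apply, Finsupp.sum, Finset.sum_filter]
      exact Finset.sum_congr rfl fun a _ => Finsupp.single_apply
    have hval : ∀ (S : Finset (Fin n → ℤ)) (h : H), S ⊆ F.coeff.support →
        (∀ u' ∈ S, u' ≠ u ∧ ψ u' = h) →
        tropTerm v F w u < v (∑ u' ∈ S, F.coeff u') + ((χ h : ℝ) : WithTop ℝ) := by
      intro S h hS hS'
      by_cases hSe : S.Nonempty
      · have hle : S.inf (fun u' => v (F.coeff u')) ≤ v (∑ u' ∈ S, F.coeff u') :=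
          AddValuation.map_le_sum v fun i hi => Finset.inf_le hi
        obtain ⟨a, ha, hae⟩ := Finset.exists_mem_eq_inf S hSe (fun u' => v (F.coeff u'))
        have h1 := hlt a (hS ha) (hS' a ha).1
        refine lt_of_lt_of_le h1 ?_
        have h2 : tropTerm v F w a = v (F.coeff a) + ((χ h : ℝ) : WithTop ℝ) := by
          rw [tropTerm, hw, AddMonoidHom.comp_apply, (hS' a ha).2]
        rw [h2]
        rw [hae] at hle
        gcongr
      · rw [Finset.not_nonempty_iff_eq_empty] at hSe
        subst hSe
        rw [Finset.sum_empty, AddValuation.map_zero, WithTop.top_add]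
        exact lt_top_iff_ne_top.mpr (tropTerm_ne_top v F w hu)
    have hother : ∀ h, h ≠ ψ u → tropTerm v F w u < tropTerm v f χ h := by
      intro h hh
      rw [tropTerm.eq_def v f, hfc]
      refine hval _ h (Finset.filter_subset _ _) fun u' hu' => ?_
      have := (Finset.mem_filter.mp hu').2
      exact ⟨fun e => hh (by rw [← this, e]), this⟩
    have hmain : tropTerm v f χ (ψ u) = tropTerm v F w u := by
      have hum : u ∈ F.coeff.support.filter fun u' => ψ u' = ψ u :=
        Finset.mem_filter.mpr ⟨hu, rfl⟩
      have hlt' := hval ((F.coeff.support.filter fun u' => ψ u' = ψ u).erase u) (ψ u)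
        ((Finset.erase_subset _ _).trans (Finset.filter_subset _ _)) fun u' hu' =>
          ⟨Finset.ne_of_mem_erase hu', (Finset.mem_filter.mp (Finset.mem_of_mem_erase hu')).2⟩
      have hlt2 : v (F.coeff u) <
          v (∑ u' ∈ (F.coeff.support.filter fun u' => ψ u' = ψ u).erase u, F.coeff u') :=
        lt_of_add_lt_add_right (a := ((χ (ψ u) : ℝ) : WithTop ℝ)) hlt'
      rw [tropTerm, tropTerm, hfc, ← Finset.add_sum_erase _ _ hum,
        AddValuation.map_add_eq_of_lt_left v hlt2]
      rfl
    have hfne : f.coeff (ψ u) ≠ 0 := by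
      intro h0
      apply tropTerm_ne_top v F w hu
      rw [← hmain, tropTerm, h0, AddValuation.map_zero, WithTop.top_add]
    have hf0 : f ≠ 0 := fun h0 => hfne (by rw [h0]; rfl)
    have hpoly : tropPoly v f χ ≤ tropTerm v F w u := by
      rw [← hmain]
      exact Finset.inf_le (Finsupp.mem_support_iff.mpr hfne)
    obtain ⟨a, -, b, -, hab, h1, h2⟩ := hD f hF hf0
    have ha : a = ψ u := by
      by_contra hc
      exact absurd (hother a hc) (not_lt.mpr (h1 ▸ hpoly))
    have hb : b = ψ u := by
      by_contra hc
      exact absurd (hother b hc) (not_lt.mpr (h2 ▸ hpoly))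
    exact hab (ha.trans hb.symm)

/-- The tropical variety of `I` may be computed with any epimorphism `ψ : ℤⁿ → H`. -/
theorem tropField_eq {n : ℕ} (ψ : (Fin n → ℤ) →+ H) (hψ : Function.Surjective ψ)
    (I : Ideal (AddMonoidAlgebra k H)) :
    tropField v I = {χ | χ.comp ψ ∈ tropLaurent v (liftIdeal ψ I)} := by
  ext χ
  constructor
  · intro h
    exact h n ψ hψ
  · intro h m φ hφ
    exact (comp_mem_tropLaurent_iff v φ hφ I χ).mpr ((comp_mem_tropLaurent_iff v ψ hψ I χ).mp h)

end Field

/-! ### The valuations -/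

/-- The trivial valuation on a field: `0 ↦ ∞`, and every nonzero element goes to `0`. -/
def trivialVal (k : Type*) [Field k] : AddValuation k (WithTop ℝ) :=
  AddValuation.of (fun x => if x = 0 then ⊤ else 0) (by simp) (by simp)
    (by
      intro x y
      by_cases hx : x = 0
      · simp [hx]
      · by_cases hy : y = 0
        · simp [hy]
        · simp only [hx, hy, if_false, min_self]
          split_ifs <;> simp)
    (by
      intro x y
      by_cases hx : x = 0
      · simp [hx]
      · by_cases hy : y = 0 <;> simp [hx, hy])

instance factPrimeOfPrimes (p : Nat.Primes) : Fact (p : ℕ).Prime := ⟨p.2⟩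

/-- The `p`-adic valuation on `ℚ`, normalised by `v_p(p) = 1`. -/
def padicVal (p : Nat.Primes) : AddValuation ℚ (WithTop ℝ) :=
  AddValuation.of (fun x => if x = 0 then ⊤ else (((padicValRat p x : ℤ) : ℝ) : WithTop ℝ))
    (by simp) (by simp)
    (by
      intro x y
      by_cases hx : x = 0
      · simp [hx]
      · by_cases hy : y = 0
        · simp [hy]
        · by_cases hxy : x + y = 0
          · simp [hxy]
          · have h := padicValRat.min_le_padicValRat_add (p := (p : ℕ)) hxy
            simp only [hx, hy, hxy, if_false]
            rw [min_le_iff] at h ⊢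
            simpa only [WithTop.coe_le_coe, Int.cast_le] using h)
    (by
      intro x y
      by_cases hx : x = 0
      · simp [hx]
      · by_cases hy : y = 0
        · simp [hy]
        · simp only [hx, hy, mul_eq_zero, or_self, if_false]
          rw [padicValRat.mul hx hy]
          push_cast
          rfl)

/-! ### Change of coefficients and the union of tropical varieties -/

/-- For an ideal `I` of `ℤ[H]`, the ideal `I ⊗ k` of `k[H] = ℤ[H] ⊗ k`, i.e. the ideal of `k[H]`
generated by the image of `I`. -/
def extendIdeal {H : Type*} [AddCommGroup H] (k : Type*) [Field k]
    (I : Ideal (AddMonoidAlgebra ℤ H)) : Ideal (AddMonoidAlgebra k H) :=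
  I.map (AddMonoidAlgebra.mapRingHom H (Int.castRingHom k))

/-- The union of `Trop_{ℚ,v₀}(I ⊗ ℚ)` with the sets `Trop_{ℚ,v_p}(I ⊗ ℚ)` and
`Trop_{𝔽_p}(I ⊗ 𝔽_p)` (trivial valuation on `𝔽_p`), where `p` runs over a set `P` of primes. -/
def tropUnion {H : Type*} [AddCommGroup H] (I : Ideal (AddMonoidAlgebra ℤ H))
    (P : Set Nat.Primes) : Set (H →+ ℝ) :=
  tropField (trivialVal ℚ) (extendIdeal ℚ I) ∪
    ⋃ p ∈ P, (tropField (padicVal p) (extendIdeal ℚ I) ∪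
      tropField (trivialVal (ZMod p)) (extendIdeal (ZMod p) I))

end

/-!
A character `χ` is outside `Trop_ℤ(I)` exactly if `I` contains an element of the form `1 + g` with
`g` of positive `χ`-degree. If it contains none, Chevalley's extension theorem provides a
multiplicatively written valuation `w` of `ℤ[H]` that vanishes on `I`, is at most `1` on the
subring of nonnegative `χ`-degree and less than `1` in positive degree. On nonzero integers it has
the form `w(a) = q ^ v_p(a)`, `q = w(p)`, for some prime `p`. For `χ h₀ > 0`, compare `q` with
`u = w(h₀)`. If `u` is infinitely small relative to `q`, then `χ` lies in `Trop_{ℚ,v₀}`; if `q` is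
infinitely small relative to `u`, then `χ` lies in `Trop_{𝔽_p}`; and if they are commensurable, a
positive multiple of `χ`, found by a Dedekind cut, lies in `Trop_{ℚ,v_p}`.

Finitely many primes suffice because finitely many `F ∈ I` witness all `χ ∉ Trop_{ℚ,v₀}`: a prime
that divides no coefficient of the witness `F` for `χ` contributes nothing at `χ`. The existence of
these witnesses is a compactness statement. Let the characters range over an ultraproduct of `ℝ`,
and lift to a homogeneous ideal of a polynomial ring. The initial spaces of its homogeneous parts
have a dimension independent of the character, so those of a limit character, being generated by
finitely many leading parts, agree with those of every character that orders a certain finite set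
of exponents in the same way.
-/

noncomputable section

open scoped AddMonoidAlgebra

/-! ### Initial submodules -/

section InitialSubmodule

open AddMonoidAlgebra

variable {R M Γ : Type*}

open Classical in
/-- The part of degree `δ` of an element of `R[M]`, for the grading given by `χ : M → Γ`. -/
def degreePart [Semiring R] (χ : M → Γ) (δ : Γ) : R[M] →ₗ[R] R[M] where
  toFun f := ofCoeff (f.coeff.filter fun m => χ m = δ)
  map_add' _ _ := congrArg ofCoeff (Finsupp.filter_add ..)
  map_smul' _ _ := congrArg ofCoeff (Finsupp.filter_smul ..)

/-- The leading parts of degree `δ` of a submodule `V`: the degree-`δ` parts of those elements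
of `V` that have no part of degree less than `δ`. -/
def initialPiece [Semiring R] [LE Γ] (χ : M → Γ) (δ : Γ) (V : Submodule R R[M]) :
    Submodule R R[M] :=
  (V ⊓ supported R R {m | δ ≤ χ m}).map (degreePart χ δ)

/-- The initial submodule of `V`, spanned by the leading parts of its elements. -/
def initialSubmodule [Semiring R] [LE Γ] (χ : M → Γ) (V : Submodule R R[M]) : Submodule R R[M] :=
  ⨆ δ, initialPiece χ δ V

/-- The minimum of `χ` on the support of `f` is attained exactly once. -/
def HasUniqueMin [Semiring R] [LT Γ] (χ : M → Γ) (f : R[M]) : Prop :=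
  ∃ m, f.coeff m ≠ 0 ∧ ∀ m', f.coeff m' ≠ 0 → m' ≠ m → χ m < χ m'

section Semiring

variable [Semiring R] {χ : M → Γ} {δ : Γ} {f : R[M]}

theorem coeff_degreePart_of_eq {m : M} (h : χ m = δ) :
    (degreePart χ δ f).coeff m = f.coeff m := by
  classical exact Finsupp.filter_apply_pos (χ · = δ) _ h

theorem coeff_degreePart_of_ne {m : M} (h : χ m ≠ δ) : (degreePart χ δ f).coeff m = 0 := by
  classical exact Finsupp.filter_apply_neg (χ · = δ) _ h

theorem single_mem_supported {S : Set M} {m : M} (hm : m ∈ S) (a : R) :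
    single m a ∈ supported R R S :=
  Finsupp.single_mem_supported R a hm

theorem degreePart_mem_supported : degreePart χ δ f ∈ supported R R {m | χ m = δ} :=
  mem_supported'.mpr fun _ hm => coeff_degreePart_of_ne hm

theorem degreePart_eq_self (hf : f ∈ supported R R {m | χ m = δ}) : degreePart χ δ f = f := by
  ext m
  by_cases hm : χ m = δ
  · exact coeff_degreePart_of_eq hm
  · rw [coeff_degreePart_of_ne hm, mem_supported'.mp hf m hm]

theorem degreePart_eq_zero_iff : degreePart χ δ f = 0 ↔ f ∈ supported R R {m | χ m ≠ δ} := by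
  rw [mem_supported']
  constructor
  · intro h m hm
    rw [← coeff_degreePart_of_eq (not_not.mp hm), h, coeff_zero, Finsupp.zero_apply]
  · intro h
    ext m
    by_cases hm : χ m = δ
    · rw [coeff_degreePart_of_eq hm, h m (not_not.mpr hm), coeff_zero, Finsupp.zero_apply]
    · exact coeff_degreePart_of_ne hm

theorem degreePart_single_of_eq {m : M} (h : χ m = δ) (a : R) :
    degreePart χ δ (single m a) = single m a :=
  degreePart_eq_self (single_mem_supported (S := {m | χ m = δ}) h a)

theorem degreePart_single_of_ne {m : M} (h : χ m ≠ δ) (a : R) :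
    degreePart χ δ (single m a) = 0 :=
  degreePart_eq_zero_iff.mpr (single_mem_supported (S := {m | χ m ≠ δ}) h a)

theorem coeff_degreePart_of_coeff_eq_zero {m : M} (hm : f.coeff m = 0) :
    (degreePart χ δ f).coeff m = 0 := by
  by_cases hδ : χ m = δ
  · rw [coeff_degreePart_of_eq hδ, hm]
  · exact coeff_degreePart_of_ne hδ

variable [LinearOrder Γ] {V : Submodule R R[M]}

theorem initialPiece_le_supported : initialPiece χ δ V ≤ supported R R {m | χ m = δ} := by
  rintro _ ⟨f, -, rfl⟩
  exact degreePart_mem_supported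

theorem initialPiece_le_initialSubmodule : initialPiece χ δ V ≤ initialSubmodule χ V :=
  le_iSup (initialPiece χ · V) δ

theorem initialSubmodule_le_supported {S : Set M} (hV : V ≤ supported R R S) :
    initialSubmodule χ V ≤ supported R R S := by
  refine iSup_le fun δ => ?_
  rintro _ ⟨f, hf, rfl⟩
  exact mem_supported'.mpr fun m hm =>
    coeff_degreePart_of_coeff_eq_zero (mem_supported'.mp (hV hf.1) m hm)

theorem map_degreePart_initialSubmodule :
    (initialSubmodule χ V).map (degreePart χ δ) = initialPiece χ δ V := by
  refine le_antisymm ?_ fun y hy => ⟨y, initialPiece_le_initialSubmodule hy,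
    degreePart_eq_self (initialPiece_le_supported hy)⟩
  rw [initialSubmodule, Submodule.map_iSup]
  refine iSup_le fun δ' => Submodule.map_le_iff_le_comap.mpr fun y hy => ?_
  have hyδ' := initialPiece_le_supported hy
  obtain rfl | hne := eq_or_ne δ' δ
  · rwa [Submodule.mem_comap, degreePart_eq_self hyδ']
  · rw [Submodule.mem_comap, degreePart_eq_zero_iff.mpr
      (supported_mono (fun m (hm : χ m = δ') => (hm.trans_ne hne)) hyδ')]
    exact Submodule.zero_mem _

theorem mem_initialPiece_iff (hf : f ∈ supported R R {m | χ m = δ}) :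
    f ∈ initialPiece χ δ V ↔ f ∈ initialSubmodule χ V := by
  refine ⟨fun h => initialPiece_le_initialSubmodule h, fun h => ?_⟩
  rw [← map_degreePart_initialSubmodule]
  exact ⟨f, h, degreePart_eq_self hf⟩

theorem initialSubmodule_eq_map_sup (hV : V ≤ supported R R {m | δ ≤ χ m}) :
    initialSubmodule χ V =
      V.map (degreePart χ δ) ⊔ initialSubmodule χ (V ⊓ (degreePart χ δ).ker) := by
  refine le_antisymm (iSup_le fun δ' => ?_) (sup_le ?_ ?_)
  · obtain hlt | rfl | hlt := lt_trichotomy δ' δ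
    · rintro _ ⟨f, hf, rfl⟩
      rw [degreePart_eq_zero_iff.mpr (supported_mono (fun m hm => (hlt.trans_le hm).ne') (hV hf.1))]
      exact Submodule.zero_mem _
    · exact (Submodule.map_mono inf_le_left).trans le_sup_left
    · have hker : supported R R {m | δ' ≤ χ m} ≤ (degreePart χ δ).ker := fun f hf =>
        degreePart_eq_zero_iff.mpr (supported_mono (fun m hm => (hlt.trans_le hm).ne') hf)
      rw [initialPiece, ← inf_eq_right.mpr hker, ← inf_assoc]
      exact initialPiece_le_initialSubmodule.trans le_sup_right
  · exact (Submodule.map_mono (le_inf le_rfl hV)).trans initialPiece_le_initialSubmodule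
  · exact iSup_mono fun δ' => Submodule.map_mono (inf_le_inf_right _ inf_le_left)

theorem hasUniqueMin_iff : HasUniqueMin χ f ↔
    ∃ m, ∃ a ≠ 0, f ∈ supported R R {m' | χ m ≤ χ m'} ∧ degreePart χ (χ m) f = single m a := by
  constructor
  · rintro ⟨m, hm, hmin⟩
    refine ⟨m, f.coeff m, hm, mem_supported'.mpr fun m' hm' => ?_, ?_⟩
    · by_contra h
      exact hm' (hmin m' h fun e => hm' (e ▸ le_rfl)).le
    · ext m'
      obtain rfl | hne := eq_or_ne m' m
      · rw [coeff_degreePart_of_eq rfl, coeff_single, Finsupp.single_eq_same]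
      · rw [coeff_single, Finsupp.single_eq_of_ne hne]
        by_cases e : χ m' = χ m
        · rw [coeff_degreePart_of_eq e]
          exact by_contra fun h => (hmin m' h hne).ne' e
        · exact coeff_degreePart_of_ne e
  · rintro ⟨m, a, ha, hle, hm⟩
    have coeff_eq (m' : M) (e : χ m' = χ m) : f.coeff m' = Finsupp.single m a m' := by
      rw [← coeff_single, ← hm, coeff_degreePart_of_eq e]
    refine ⟨m, by rwa [coeff_eq m rfl, Finsupp.single_eq_same], fun m' hm' hne => ?_⟩
    have hle' : χ m ≤ χ m' := by_contra fun h => hm' (mem_supported'.mp hle m' h)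
    exact hle'.lt_of_ne fun e => hm' (by rw [coeff_eq m' e.symm, Finsupp.single_eq_of_ne hne])

theorem exists_hasUniqueMin_iff :
    (∃ f ∈ V, HasUniqueMin χ f) ↔ ∃ m, ∃ a ≠ 0, single m a ∈ initialSubmodule χ V := by
  have mem_iff (m : M) (a : R) :
      single m a ∈ initialSubmodule χ V ↔ single m a ∈ initialPiece χ (χ m) V :=
    (mem_initialPiece_iff (single_mem_supported (by rfl) a)).symm
  simp only [hasUniqueMin_iff, mem_iff]
  constructor
  · rintro ⟨f, hf, m, a, ha, hle, hm⟩
    exact ⟨m, a, ha, f, ⟨hf, hle⟩, hm⟩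
  · rintro ⟨m, a, ha, f, ⟨hf, hle⟩, hm⟩
    exact ⟨f, hf, m, a, ha, hle, hm⟩

end Semiring

universe u

variable {k : Type*} [Field k]

theorem rank_map_add_rank_inf_ker {E F : Type u} [AddCommGroup E] [Module k E] [AddCommGroup F]
    [Module k F] (φ : E →ₗ[k] F) (V : Submodule k E) :
    Module.rank k (V.map φ) + Module.rank k (V ⊓ φ.ker : Submodule k E) = Module.rank k V := by
  rw [← Submodule.map_comap_subtype, (Submodule.equivSubtypeMap V _).symm.rank_eq,
    ← LinearMap.ker_domRestrict, ← LinearMap.range_domRestrict]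
  exact (φ.domRestrict V).rank_range_add_rank_ker

variable [LinearOrder Γ] {χ : M → Γ}

theorem rank_initialSubmodule {V : Submodule k k[M]} {D : Finset Γ}
    (hV : V ≤ supported k k {m | χ m ∈ D}) :
    Module.rank k (initialSubmodule χ V) = Module.rank k V := by
  induction D using Finset.induction_on_min generalizing V with
  | empty =>
    have hsupp : supported k k {m | χ m ∈ (∅ : Finset Γ)} = ⊥ :=
      (Submodule.eq_bot_iff _).mpr fun f hf => by
        ext m
        exact mem_supported'.mp hf m (Finset.notMem_empty _)
    have hI := initialSubmodule_le_supported (χ := χ) hV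
    rw [hsupp, le_bot_iff] at hV hI
    rw [hI, hV]
  | insert δ D hδ ih =>
    set V' := V ⊓ (degreePart χ δ).ker
    have hV'D : V' ≤ supported k k {m | χ m ∈ D} := fun f hf => mem_supported'.mpr fun m hm => by
      by_cases hmδ : χ m = δ
      · exact mem_supported'.mp (degreePart_eq_zero_iff.mp hf.2) m (not_not.mpr hmδ)
      · exact mem_supported'.mp (hV hf.1) m fun h => (Finset.mem_insert.mp h).elim hmδ hm
    have hVδ : V ≤ supported k k {m | δ ≤ χ m} := hV.trans <| supported_mono fun m hm =>
      (Finset.mem_insert.mp hm).elim Eq.ge fun h => (hδ _ h).le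
    have inf_eq : V.map (degreePart χ δ) ⊓ initialSubmodule χ V' = ⊥ := by
      refine (Submodule.eq_bot_iff _).mpr ?_
      rintro _ ⟨⟨f, -, rfl⟩, hf⟩
      rw [← degreePart_eq_self (degreePart_mem_supported (f := f)), degreePart_eq_zero_iff]
      exact supported_mono (fun m (hm : χ m ∈ D) => (hδ _ hm).ne')
        (initialSubmodule_le_supported hV'D hf)
    calc Module.rank k (initialSubmodule χ V)
        = Module.rank k (V.map (degreePart χ δ)) + Module.rank k (initialSubmodule χ V') := by
          rw [initialSubmodule_eq_map_sup hVδ, ← Submodule.rank_sup_add_rank_inf_eq, inf_eq,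
            rank_bot, add_zero]
      _ = Module.rank k (V.map (degreePart χ δ)) + Module.rank k V' := by rw [ih hV'D]
      _ = Module.rank k V := rank_map_add_rank_inf_ker _ _

end InitialSubmodule

section SingleMul

open AddMonoidAlgebra

variable {R M Δ : Type*} [Semiring R] [AddMonoid M]

theorem single_mul_mem_supported {S T : Set M} {b : M} (c : R) (hST : ∀ m ∈ S, b + m ∈ T)
    {f : R[M]} (hf : f ∈ supported R R S) : single b c * f ∈ supported R R T := by
  classical
  rw [mem_supported] at hf ⊢
  intro m hm
  obtain ⟨m', hm', rfl⟩ := Finset.mem_image.mp (support_coeff_single_mul_subset _ _ _ hm)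
  exact hST m' (hf hm')

variable [AddMonoid Δ] [IsLeftCancelAdd Δ]

theorem degreePart_single_mul (d : M →+ Δ) (δ : Δ) (b : M) (c : R) (f : R[M]) :
    degreePart d (d b + δ) (single b c * f) = single b c * degreePart d δ f := by
  induction f using AddMonoidAlgebra.induction_linear with
  | zero => simp only [mul_zero, map_zero]
  | add f g hf hg => rw [mul_add, map_add, map_add, mul_add, hf, hg]
  | single m a =>
    rw [single_mul_single]
    by_cases h : d m = δ
    · rw [degreePart_single_of_eq h, degreePart_single_of_eq (by rw [map_add, h]),
        single_mul_single]
    · rw [degreePart_single_of_ne h, mul_zero, degreePart_single_of_ne]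
      rw [map_add]
      exact fun e => h (add_left_cancel e)

theorem degreePart_mem_of_mem_span {d : M →+ Δ} {N : Δ → Submodule R R[M]}
    (hN : ∀ b c δ, ∀ f ∈ N δ, single b c * f ∈ N (d b + δ)) {G : Set R[M]}
    (hG : ∀ g ∈ G, ∀ δ, degreePart d δ g ∈ N δ) {f : R[M]} (hf : f ∈ Ideal.span G) (δ : Δ) :
    degreePart d δ f ∈ N δ := by
  induction hf using Submodule.span_induction generalizing δ with
  | mem g hg => exact hG g hg δ
  | zero => rw [map_zero]; exact Submodule.zero_mem _
  | add f g _ _ ihf ihg => rw [map_add]; exact Submodule.add_mem _ (ihf δ) (ihg δ)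
  | smul r f _ ih =>
    rw [smul_eq_mul]
    induction r using AddMonoidAlgebra.induction_linear with
    | zero => rw [zero_mul, map_zero]; exact Submodule.zero_mem _
    | add r s hr hs => rw [add_mul, map_add]; exact Submodule.add_mem _ hr hs
    | single b c =>
      by_cases hδ : ∃ δ', d b + δ' = δ
      · obtain ⟨δ', rfl⟩ := hδ
        rw [degreePart_single_mul]
        exact hN b c δ' _ (ih δ')
      · have hsupp : single b c * f ∈ supported R R {m | d m ≠ δ} :=
          single_mul_mem_supported (S := Set.univ) (T := {m | d m ≠ δ}) c
            (fun m _ h => hδ ⟨d m, (d.map_add b m).symm.trans h⟩) (Set.subset_univ _)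
        rw [degreePart_eq_zero_iff.mpr hsupp]
        exact Submodule.zero_mem _

end SingleMul

section Shift

open AddMonoidAlgebra

variable {R M Γ : Type*} [Semiring R] [AddMonoid M] [AddCommMonoid Γ] [LinearOrder Γ]
  [IsOrderedCancelAddMonoid Γ] {χ : M →+ Γ} {V V' : Submodule R R[M]} {b : M} {c : R}

theorem single_mul_mem_initialPiece (h : ∀ f ∈ V, single b c * f ∈ V') {δ : Γ} {y : R[M]}
    (hy : y ∈ initialPiece χ δ V) : single b c * y ∈ initialPiece χ (χ b + δ) V' := by
  obtain ⟨f, ⟨hf, hδ⟩, rfl⟩ := hy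
  refine ⟨single b c * f, ⟨h f hf, single_mul_mem_supported c (fun m hm => ?_) hδ⟩,
    degreePart_single_mul χ δ b c f⟩
  rw [Set.mem_ofPred_eq, map_add]
  exact add_le_add_right hm _

theorem single_mul_mem_initialSubmodule (h : ∀ f ∈ V, single b c * f ∈ V') {y : R[M]}
    (hy : y ∈ initialSubmodule χ V) : single b c * y ∈ initialSubmodule χ V' := by
  induction hy using Submodule.iSup_induction' with
  | mem δ y hy => exact initialPiece_le_initialSubmodule (single_mul_mem_initialPiece h hy)
  | zero => rw [mul_zero]; exact Submodule.zero_mem _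
  | add y z _ _ hy hz => rw [mul_add]; exact Submodule.add_mem _ hy hz

end Shift

/-! ### Homogeneous ideals -/

section Homogeneous

open AddMonoidAlgebra

theorem degreePart_eq_of_le_iff_le {R M Γ Γ' : Type*} [Semiring R] [PartialOrder Γ]
    [PartialOrder Γ'] {χ : M → Γ} {χ' : M → Γ'} {f : R[M]} {m₀ : M} (hm₀ : f.coeff m₀ ≠ 0)
    (h : ∀ m ∈ f.coeff.support, ∀ m' ∈ f.coeff.support, χ m ≤ χ m' ↔ χ' m ≤ χ' m') :
    degreePart χ (χ m₀) f = degreePart χ' (χ' m₀) f := by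
  ext m
  obtain hm | hm := eq_or_ne (f.coeff m) 0
  · rw [coeff_degreePart_of_coeff_eq_zero hm, coeff_degreePart_of_coeff_eq_zero hm]
  · rw [← Finsupp.mem_support_iff] at hm hm₀
    have eq_iff : χ m = χ m₀ ↔ χ' m = χ' m₀ := by
      rw [le_antisymm_iff, le_antisymm_iff, h m hm m₀ hm₀, h m₀ hm₀ m hm]
    by_cases hχ : χ m = χ m₀
    · rw [coeff_degreePart_of_eq hχ, coeff_degreePart_of_eq (eq_iff.mp hχ)]
    · rw [coeff_degreePart_of_ne hχ, coeff_degreePart_of_ne (eq_iff.not.mp hχ)]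

theorem degreePart_mem_initialSubmodule_of_le_iff_le {R M Γ Γ' : Type*} [Semiring R]
    [LinearOrder Γ] [LinearOrder Γ'] {χ : M → Γ} {χ' : M → Γ'} {V : Submodule R R[M]} {f : R[M]}
    {δ : Γ} (hf : f ∈ V) (hδ : f ∈ supported R R {m | δ ≤ χ m})
    (h : ∀ m ∈ f.coeff.support, ∀ m' ∈ f.coeff.support, χ m ≤ χ m' ↔ χ' m ≤ χ' m') :
    degreePart χ δ f ∈ initialSubmodule χ' V := by
  by_cases h0 : degreePart χ δ f = 0
  · rw [h0]; exact Submodule.zero_mem _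
  obtain ⟨m₀, rfl, hm₀⟩ : ∃ m₀, χ m₀ = δ ∧ f.coeff m₀ ≠ 0 := by
    simpa [degreePart_eq_zero_iff, mem_supported'] using h0
  rw [degreePart_eq_of_le_iff_le hm₀ h]
  refine initialPiece_le_initialSubmodule ⟨f, ⟨hf, mem_supported.mpr fun m hm => ?_⟩, rfl⟩
  exact (h m₀ (Finsupp.mem_support_iff.mpr hm₀) m hm).mp (mem_supported.mp hδ hm)

variable {ι k Γ Γ' : Type*} [Field k]

/-- The homogeneous elements of degree `D` of an ideal of the polynomial ring `k[ι →₀ ℕ]`. -/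
def homogeneousPart (P : Ideal k[ι →₀ ℕ]) (D : ℕ) : Submodule k k[ι →₀ ℕ] :=
  P.restrictScalars k ⊓ supported k k {m | m.degree = D}

theorem single_mul_mem_homogeneousPart {P : Ideal k[ι →₀ ℕ]} {D : ℕ} {f : k[ι →₀ ℕ]}
    (hf : f ∈ homogeneousPart P D) (b : ι →₀ ℕ) (c : k) :
    single b c * f ∈ homogeneousPart P (b.degree + D) :=
  ⟨P.mul_mem_left _ hf.1, single_mul_mem_supported (S := {m | m.degree = D}) c
    (T := {m | m.degree = b.degree + D}) (fun m hm => (map_add Finsupp.degree b m).trans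
      (congrArg (b.degree + ·) hm)) hf.2⟩

theorem initialSubmodule_homogeneousPart_le_supported [LinearOrder Γ] {χ : (ι →₀ ℕ) → Γ}
    {P : Ideal k[ι →₀ ℕ]} {D : ℕ} :
    initialSubmodule χ (homogeneousPart P D) ≤ supported k k {m | m.degree = D} :=
  initialSubmodule_le_supported inf_le_right

theorem rank_initialSubmodule_homogeneousPart [Finite ι] [LinearOrder Γ] (χ : (ι →₀ ℕ) → Γ)
    (P : Ideal k[ι →₀ ℕ]) (D : ℕ) :
    Module.rank k (initialSubmodule χ (homogeneousPart P D)) =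
      Module.rank k (homogeneousPart P D) := by
  have hfin : {m : ι →₀ ℕ | m.degree = D}.Finite := Finsupp.finite_of_degree_eq D
  refine rank_initialSubmodule (D := hfin.toFinset.image χ) (inf_le_right.trans ?_)
  exact supported_mono fun m hm => Finset.mem_image_of_mem χ (hfin.mem_toFinset.mpr hm)

theorem finiteDimensional_of_le_supported {M : Type*} {S : Set M} (hS : S.Finite)
    {V : Submodule k k[M]} (hV : V ≤ supported k k S) : FiniteDimensional k V := by
  have := hS.to_subtype
  have : FiniteDimensional k (supported k k S) :=
    (supportedEquivFinsupp S).symm.finiteDimensional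
  exact Submodule.finiteDimensional_of_le hV

variable [LinearOrder Γ] [AddCommMonoid Γ'] [LinearOrder Γ'] [IsOrderedCancelAddMonoid Γ']

theorem initialSubmodule_homogeneousPart_le_of_span {P : Ideal k[ι →₀ ℕ]} {χ : (ι →₀ ℕ) → Γ}
    {χ' : (ι →₀ ℕ) →+ Γ'} {G : Set k[ι →₀ ℕ]}
    (hG : ∀ g ∈ G, ∃ D, g ∈ initialSubmodule χ' (homogeneousPart P D))
    (hspan : ∀ D, ∀ f ∈ initialSubmodule χ (homogeneousPart P D), f ∈ Ideal.span G) (D : ℕ) :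
    initialSubmodule χ (homogeneousPart P D) ≤ initialSubmodule χ' (homogeneousPart P D) := by
  intro f hf
  rw [← degreePart_eq_self (initialSubmodule_homogeneousPart_le_supported hf)]
  have single_mul_mem (b : ι →₀ ℕ) (c : k) (D : ℕ) :
      ∀ f ∈ initialSubmodule χ' (homogeneousPart P D), single b c * f ∈
      initialSubmodule χ' (homogeneousPart P (b.degree + D)) := fun f =>
    single_mul_mem_initialSubmodule fun f hf => single_mul_mem_homogeneousPart hf b c
  refine degreePart_mem_of_mem_span (d := Finsupp.degree) single_mul_mem
    (fun g hg E => ?_) (hspan D f hf) D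
  obtain ⟨D', hgD'⟩ := hG g hg
  have hg_supp := initialSubmodule_homogeneousPart_le_supported hgD'
  obtain rfl | hne := eq_or_ne D' E
  · exact (degreePart_eq_self hg_supp).symm ▸ hgD'
  · have hg_supp_ne : g ∈ supported k k {m | Finsupp.degree m ≠ E} :=
      supported_mono (s := {m | Finsupp.degree m = D'}) (fun m hm => Eq.trans_ne hm hne) hg_supp
    rw [degreePart_eq_zero_iff.mpr hg_supp_ne]
    exact Submodule.zero_mem _

theorem exists_finset_initialSubmodule_homogeneousPart_eq [Finite ι] (P : Ideal k[ι →₀ ℕ])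
    (χ : (ι →₀ ℕ) → Γ) :
    ∃ S : Finset (ι →₀ ℕ), ∀ χ' : (ι →₀ ℕ) →+ Γ',
      (∀ m ∈ S, ∀ m' ∈ S, χ m ≤ χ m' ↔ χ' m ≤ χ' m') →
      ∀ D, initialSubmodule χ' (homogeneousPart P D) =
        initialSubmodule χ (homogeneousPart P D) := by
  classical
  have : IsNoetherianRing k[ι →₀ ℕ] := inferInstanceAs (IsNoetherianRing (MvPolynomial ι k))
  set E : Set k[ι →₀ ℕ] := {y | ∃ D δ, y ∈ initialPiece χ δ (homogeneousPart P D)}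
  obtain ⟨G, hGE, hG⟩ := (Submodule.fg_span_iff_fg_span_finset_subset E).mp
    (IsNoetherian.noetherian (Ideal.span E))
  choose! D δ f hf hfg using show ∀ g ∈ G, ∃ D δ, g ∈ initialPiece χ δ (homogeneousPart P D)
    from hGE
  refine ⟨G.biUnion fun g => (f g).coeff.support, fun χ' hχ' D' => Eq.symm ?_⟩
  have : FiniteDimensional k (initialSubmodule χ' (homogeneousPart P D')) :=
    finiteDimensional_of_le_supported (Finsupp.finite_of_degree_eq D')
      initialSubmodule_homogeneousPart_le_supported
  refine Submodule.eq_of_le_of_finrank_eq (initialSubmodule_homogeneousPart_le_of_span (G := G)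
    (fun g hg => ⟨D g, ?_⟩) (fun D y hy => ?_) D') ?_
  · have support_subset {m} (hm : m ∈ (f g).coeff.support) :
        m ∈ G.biUnion fun g => (f g).coeff.support := Finset.mem_biUnion.mpr ⟨g, hg, hm⟩
    have hmem := degreePart_mem_initialSubmodule_of_le_iff_le (hf g hg).1 (hf g hg).2
      fun m hm m' hm' => hχ' m (support_subset hm) m' (support_subset hm')
    rwa [hfg g hg] at hmem
  · suffices h : initialSubmodule χ (homogeneousPart P D) ≤ (Ideal.span E).restrictScalars k from
      (hG ▸ h hy : y ∈ Submodule.span _ _)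
    exact iSup_le fun δ y hy => Submodule.subset_span ⟨D, δ, hy⟩
  · rw [Module.finrank, Module.finrank, rank_initialSubmodule_homogeneousPart,
      rank_initialSubmodule_homogeneousPart]

end Homogeneous

section GroupAlgebra

open AddMonoidAlgebra

theorem HasUniqueMin.mapDomain_of_comp {R M N Γ : Type*} [Semiring R] [Preorder Γ]
    {χ : N → Γ} {σ : M → N} {f : R[M]} (h : HasUniqueMin (χ ∘ σ) f) :
    HasUniqueMin χ (mapDomain σ f) := by
  classical
  obtain ⟨m, hm, hmin⟩ := h
  refine ⟨σ m, ?_, fun n hn hne => ?_⟩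
  · suffices (mapDomain σ f).coeff (σ m) = f.coeff m from this.trans_ne hm
    rw [coeff_mapDomain, Finsupp.mapDomain, Finsupp.sum_apply, Finsupp.sum,
      Finset.sum_eq_single m _ fun hm' => absurd (Finsupp.mem_support_iff.mpr hm) hm',
      Finsupp.single_eq_same]
    exact fun m' hm' hne => Finsupp.single_eq_of_ne fun e =>
      (hmin m' (Finsupp.mem_support_iff.mp hm') hne).ne (congrArg χ e)
  · obtain ⟨m', hm', rfl⟩ := Finset.mem_image.mp
      (Finsupp.mapDomain_support (Finsupp.mem_support_iff.mpr hn))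
    exact hmin m' (Finsupp.mem_support_iff.mp hm') fun e => hne (congrArg σ e)

variable {ι k H Γ Γ' : Type*} [Field k] [AddCommGroup H]

theorem exists_addMonoidHom_forall_eventually_degree_eq (H : Type*) [AddCommGroup H]
    [AddGroup.FG H] : ∃ (n : ℕ) (σ : (Option (Fin n) →₀ ℕ) →+ H),
      ∀ h, ∀ᶠ d in Filter.atTop, ∃ m, m.degree = d ∧ σ m = h := by
  obtain ⟨n, f, hf⟩ := AddSubmonoid.fg_iff_exists_fin_addMonoidHom.mp
    (AddMonoid.fg_def.mp (AddGroup.fg_iff_addMonoid_fg.mp ‹AddGroup.FG H›))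
  let r : (Option (Fin n) →₀ ℕ) →+ (Fin n → ℕ) :=
    { toFun := fun m i => m (some i), map_zero' := rfl, map_add' := fun _ _ => rfl }
  refine ⟨n, f.comp r, fun h => ?_⟩
  obtain ⟨g, rfl⟩ : h ∈ AddMonoidHom.mrange f := hf ▸ AddSubmonoid.mem_top h
  filter_upwards [Filter.eventually_ge_atTop (∑ i, g i)] with d hd
  refine ⟨Finsupp.equivFunOnFinite.symm fun o => o.elim (d - ∑ i, g i) g, ?_, rfl⟩
  rw [Finsupp.degree_eq_sum, Fintype.sum_option]
  exact Nat.sub_add_cancel hd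

theorem exists_mem_homogeneousPart_mapDomain_eq {σ : (ι →₀ ℕ) →+ H}
    (hσ : ∀ h, ∀ᶠ d in Filter.atTop, ∃ m, m.degree = d ∧ σ m = h) {J : Ideal k[H]} {f : k[H]}
    (hf : f ∈ J) : ∃ t : H → ι →₀ ℕ, Function.RightInverse t σ ∧
      ∃ D, mapDomain t f ∈ homogeneousPart (J.comap (mapDomainRingHom k σ)) D := by
  classical
  obtain ⟨D, hD⟩ := ((Finset.eventually_all f.coeff.support).mpr fun h _ => hσ h).exists
  have exists_lift (h : H) : ∃ m, σ m = h ∧ (h ∈ f.coeff.support → m.degree = D) := by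
    by_cases hh : h ∈ f.coeff.support
    · exact (hD h hh).imp fun m hm => ⟨hm.2, fun _ => hm.1⟩
    · obtain ⟨-, m, -, hm⟩ := (hσ h).exists
      exact ⟨m, hm, fun hh' => absurd hh' hh⟩
  choose t ht htD using exists_lift
  refine ⟨t, ht, D, ?_, mem_supported.mpr fun m hm => ?_⟩
  · change mapDomain σ (mapDomain t f) ∈ J
    convert hf
    ext : 1
    rw [coeff_mapDomain, coeff_mapDomain, ← Finsupp.mapDomain_comp, show σ ∘ t = id from funext ht,
      Finsupp.mapDomain_id]
  · obtain ⟨h, hh, rfl⟩ := Finset.mem_image.mp (Finsupp.mapDomain_support hm)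
    exact htD h hh

theorem exists_mem_homogeneousPart_hasUniqueMin_iff [Preorder Γ] {σ : (ι →₀ ℕ) →+ H}
    (hσ : ∀ h, ∀ᶠ d in Filter.atTop, ∃ m, m.degree = d ∧ σ m = h) {J : Ideal k[H]} {χ : H → Γ} :
    (∃ D, ∃ F ∈ homogeneousPart (J.comap (mapDomainRingHom k σ)) D, HasUniqueMin (χ ∘ σ) F) ↔
      ∃ f ∈ J, HasUniqueMin χ f := by
  constructor
  · rintro ⟨D, F, hF, hmin⟩
    exact ⟨mapDomain σ F, hF.1, hmin.mapDomain_of_comp⟩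
  · rintro ⟨f, hf, hmin⟩
    obtain ⟨t, ht, D, hD⟩ := exists_mem_homogeneousPart_mapDomain_eq hσ hf
    refine ⟨D, mapDomain t f, hD, HasUniqueMin.mapDomain_of_comp ?_⟩
    rwa [Function.comp_assoc, ht.comp_eq_id, Function.comp_id]

variable [AddGroup.FG H] [LinearOrder Γ] [AddCommMonoid Γ'] [LinearOrder Γ']
  [IsOrderedCancelAddMonoid Γ']

theorem exists_finset_forall_le_iff_le_imp_hasUniqueMin (J : Ideal k[H]) (χ : H → Γ) :
    ∃ S : Finset H, ∀ χ' : H →+ Γ', (∀ g ∈ S, ∀ h ∈ S, χ g ≤ χ h ↔ χ' g ≤ χ' h) →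
      (∃ f ∈ J, HasUniqueMin χ' f) → ∃ f ∈ J, HasUniqueMin χ f := by
  classical
  obtain ⟨n, σ, hσ⟩ := exists_addMonoidHom_forall_eventually_degree_eq H
  obtain ⟨S, hS⟩ := exists_finset_initialSubmodule_homogeneousPart_eq (Γ' := Γ')
    (J.comap (mapDomainRingHom k σ)) (χ ∘ σ)
  refine ⟨S.image σ, fun χ' hχ' hmin => ?_⟩
  have initialSubmodule_eq := hS (χ'.comp σ) fun m hm m' hm' =>
    hχ' _ (Finset.mem_image_of_mem σ hm) _ (Finset.mem_image_of_mem σ hm')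
  simp only [← exists_mem_homogeneousPart_hasUniqueMin_iff hσ, exists_hasUniqueMin_iff]
    at hmin ⊢
  simpa only [← initialSubmodule_eq, AddMonoidHom.coe_comp] using hmin

end GroupAlgebra

section FiniteBasis

open Filter AddMonoidAlgebra

theorem HasUniqueMin.eventually_of_germ {R M Γ ι : Type*} [Semiring R] [Preorder Γ]
    {φ : Ultrafilter ι} {χ : ι → M → Γ} {f : R[M]}
    (h : HasUniqueMin (fun m => ((fun i => χ i m : ι → Γ) : Germ (φ : Filter ι) Γ)) f) :
    ∀ᶠ i in (φ : Filter ι), HasUniqueMin (χ i) f := by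
  obtain ⟨m, hm, hmin⟩ := h
  have lt_eventually : ∀ᶠ i in (φ : Filter ι), ∀ m' ∈ f.coeff.support, m' ≠ m → χ i m < χ i m' := by
    rw [Finset.eventually_all]
    intro m' hm'
    by_cases hne : m' = m
    · exact Eventually.of_forall fun i h => absurd hne h
    · exact (Germ.coe_lt.mp (hmin m' (Finsupp.mem_support_iff.mp hm') hne)).mono fun i h _ => h
  exact lt_eventually.mono fun i hi =>
    ⟨m, hm, fun m' hm' => hi m' (Finsupp.mem_support_iff.mpr hm')⟩

theorem eventually_germ_le_iff_le {M Γ ι : Type*} [LinearOrder Γ] (φ : Ultrafilter ι)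
    (χ : ι → M → Γ) (S : Finset M) :
    ∀ᶠ i in (φ : Filter ι), ∀ m ∈ S, ∀ m' ∈ S,
      ((fun i => χ i m : ι → Γ) : Germ (φ : Filter ι) Γ) ≤ (fun i => χ i m' : ι → Γ) ↔
        χ i m ≤ χ i m' := by
  simp only [Finset.eventually_all]
  intro m _ m' _
  by_cases hle : ∀ᶠ i in (φ : Filter ι), χ i m ≤ χ i m'
  · exact hle.mono fun i hi => iff_of_true (Germ.coe_le.mpr hle) hi
  · exact (Ultrafilter.eventually_not.mpr hle).mono fun i hi =>
      iff_of_false (fun h => hle (Germ.coe_le.mp h)) hi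

theorem exists_finset_forall_hasUniqueMin {k H Γ : Type*} [Field k] [AddCommGroup H]
    [AddGroup.FG H] [AddCommMonoid Γ] [LinearOrder Γ] [IsOrderedCancelAddMonoid Γ]
    (J : Ideal k[H]) :
    ∃ B : Finset J, ∀ χ : H →+ Γ, (∃ f ∈ J, HasUniqueMin χ f) →
      ∃ f ∈ B, HasUniqueMin χ (f : k[H]) := by
  by_contra! hcon
  choose χ hχ hχB using hcon
  -- The limit of the characters `χ B`, each a counterexample for `B`, along an ultrafilter has
  -- no element of `J` with a unique minimum, although the `χ B` with large `B` order any given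
  -- finite subset of `H` like the limit does.
  let φ : Ultrafilter (Finset J) := Ultrafilter.of atTop
  obtain ⟨S, hS⟩ := exists_finset_forall_le_iff_le_imp_hasUniqueMin (Γ' := Γ) J
    fun h => ((fun B => χ B h : Finset J → Γ) : Germ (φ : Filter (Finset J)) Γ)
  obtain ⟨B, hB⟩ := (eventually_germ_le_iff_le φ (fun B => χ B) S).exists
  obtain ⟨f, hf, hmin⟩ := hS (χ B) hB (hχ B)
  have mem_eventually : ∀ᶠ B : Finset J in (φ : Filter (Finset J)), ⟨f, hf⟩ ∈ B :=
    Ultrafilter.of_le atTop <|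
      (eventually_ge_atTop {(⟨f, hf⟩ : J)}).mono fun B => Finset.singleton_subset_iff.mp
  obtain ⟨B, hB, hfB⟩ := (hmin.eventually_of_germ.and mem_eventually).exists
  exact hχB B _ hfB hB

end FiniteBasis

/-! ### Tropical varieties and unique minima -/

section InitialIdeal

open AddMonoidAlgebra

variable {R H : Type*} [CommRing R] [AddCommGroup H] {χ : H →+ ℝ} {f : R[H]}

theorem initialForm_eq_degreePart {δ : ℝ} (hf : f ∈ supported R R {m | δ ≤ χ m})
    (hδ : degreePart χ δ f ≠ 0) : initialForm χ f = degreePart χ δ f := by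
  obtain ⟨m₀, rfl, hm₀⟩ : ∃ m₀, χ m₀ = δ ∧ f.coeff m₀ ≠ 0 := by
    simpa [degreePart_eq_zero_iff, mem_supported'] using hδ
  ext m
  change (f.coeff.filter fun m => ∀ m' ∈ f.coeff.support, χ m ≤ χ m') m =
    (f.coeff.filter fun m => χ m = χ m₀) m
  rw [Finsupp.filter_apply, Finsupp.filter_apply]
  obtain hm | hm := eq_or_ne (f.coeff m) 0
  · rw [hm, ite_self, ite_self]
  · have isMin_iff : (∀ m' ∈ f.coeff.support, χ m ≤ χ m') ↔ χ m = χ m₀ :=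
      ⟨fun h => (h m₀ (Finsupp.mem_support_iff.mpr hm₀)).antisymm
        (mem_supported.mp hf (Finsupp.mem_support_iff.mpr hm)),
        fun h m' hm' => h.trans_le (mem_supported.mp hf hm')⟩
    simp only [isMin_iff]

theorem exists_initialForm_eq_degreePart (χ : H →+ ℝ) (f : R[H]) :
    ∃ δ, f ∈ supported R R {m | δ ≤ χ m} ∧ initialForm χ f = degreePart χ δ f := by
  obtain rfl | hf := eq_or_ne f 0
  · exact ⟨0, Submodule.zero_mem _,
      (congrArg ofCoeff (Finsupp.filter_zero _)).trans (map_zero _).symm⟩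
  obtain ⟨m₀, hm₀, hmin⟩ := f.coeff.support.exists_min_image χ
    (Finsupp.support_nonempty_iff.mpr (coeff_eq_zero.not.mpr hf))
  have hsupp : f ∈ supported R R {m | χ m₀ ≤ χ m} := mem_supported.mpr hmin
  refine ⟨χ m₀, hsupp, initialForm_eq_degreePart hsupp fun h => ?_⟩
  exact Finsupp.mem_support_iff.mp hm₀
    (mem_supported'.mp (degreePart_eq_zero_iff.mp h) m₀ (not_not.mpr rfl))

theorem degreePart_mem_initialPiece_of_mem_initialIdeal {I : Ideal R[H]}
    (hf : f ∈ initialIdeal χ I) (δ : ℝ) :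
    degreePart χ δ f ∈ initialPiece χ δ (I.restrictScalars R) := by
  refine degreePart_mem_of_mem_span (N := (initialPiece χ · (I.restrictScalars R)))
    (fun b c δ y hy => single_mul_mem_initialPiece (fun f hf => I.mul_mem_left _ hf) hy) ?_ hf δ
  rintro _ ⟨f, hf, rfl⟩ δ
  obtain ⟨ε, hε, hform⟩ := exists_initialForm_eq_degreePart χ f
  rw [hform]
  obtain rfl | hne := eq_or_ne ε δ
  · rw [degreePart_eq_self degreePart_mem_supported]
    exact ⟨f, ⟨hf, hε⟩, rfl⟩
  · have hsupp : degreePart χ ε f ∈ supported R R {m | χ m ≠ δ} :=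
      supported_mono (s := {m | χ m = ε}) (fun m hm => Eq.trans_ne hm hne) degreePart_mem_supported
    rw [degreePart_eq_zero_iff.mpr hsupp]
    exact Submodule.zero_mem _

theorem sub_one_mem_supported_pos_iff :
    f - 1 ∈ supported R R {h | 0 < χ h} ↔
      f ∈ supported R R {h | 0 ≤ χ h} ∧ degreePart χ 0 f = 1 := by
  have one_mem : (1 : R[H]) ∈ supported R R {h | χ h = 0} :=
    single_mem_supported (S := {h | χ h = 0}) (map_zero χ) 1
  have one_mem_nonneg : (1 : R[H]) ∈ supported R R {h | 0 ≤ χ h} :=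
    supported_mono (s := {h | χ h = 0}) (fun h => Eq.ge) one_mem
  have pos_eq : {h | 0 < χ h} = {h | 0 ≤ χ h} ∩ {h | χ h ≠ 0} := by
    ext h
    exact Set.mem_ofPred_eq ▸ lt_iff_le_and_ne'
  have degreePart_eq_one_iff :
      degreePart χ 0 f = 1 ↔ f - 1 ∈ supported R R {h | χ h ≠ 0} := by
    rw [← degreePart_eq_zero_iff, map_sub, degreePart_eq_self one_mem, sub_eq_zero]
  rw [degreePart_eq_one_iff, ← Submodule.sub_mem_iff_left _ one_mem_nonneg, pos_eq]
  simp only [mem_supported, Set.subset_inter_iff]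

theorem notMem_tropRing_iff {I : Ideal R[H]} :
    χ ∉ tropRing I ↔ ∃ f ∈ I, f - 1 ∈ supported R R {h | 0 < χ h} := by
  simp only [sub_one_mem_supported_pos_iff, tropRing, Set.mem_ofPred_eq, not_not,
    Ideal.eq_top_iff_one]
  constructor
  · intro h
    obtain ⟨f, hf, h1⟩ := degreePart_mem_initialPiece_of_mem_initialIdeal h 0
    exact ⟨f, hf.1, hf.2, h1.trans (degreePart_single_of_eq (map_zero χ) 1)⟩
  · rintro ⟨f, hf, hsupp, h1⟩
    obtain _ | _ := subsingleton_or_nontrivial R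
    · exact Subsingleton.elim (0 : R[H]) 1 ▸ Submodule.zero_mem _
    · refine Submodule.subset_span ⟨f, hf, ?_⟩
      rw [initialForm_eq_degreePart hsupp (h1.trans_ne one_ne_zero), h1]

end InitialIdeal

section TropField

open AddMonoidAlgebra

variable {K H : Type*} [Field K] [AddCommGroup H] {v : AddValuation K (WithTop ℝ)} {χ : H →+ ℝ}

theorem mem_tropHypersurface_iff {f : K[H]} (hf : f ≠ 0) :
    χ ∈ tropHypersurface v f ↔ ¬ HasUniqueMin (tropTerm v f χ) f := by
  obtain ⟨u, hu, hmin⟩ := f.coeff.support.exists_mem_eq_inf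
    (Finsupp.support_nonempty_iff.mpr (coeff_eq_zero.not.mpr hf)) (tropTerm v f χ)
  have tropPoly_le {u'} (hu' : u' ∈ f.coeff.support) : tropPoly v f χ ≤ tropTerm v f χ u' :=
    Finset.inf_le hu'
  constructor
  · rintro ⟨a, ha, b, hb, hab, hva, hvb⟩ ⟨m, hm, hlt⟩
    have eq_m {c} (hc : c ∈ f.coeff.support) (hvc : tropTerm v f χ c = tropPoly v f χ) : c = m :=
      by_contra fun hne => (hlt c (Finsupp.mem_support_iff.mp hc) hne).not_ge
        (hvc.trans_le (tropPoly_le (Finsupp.mem_support_iff.mpr hm)))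
    exact hab ((eq_m ha hva).trans (eq_m hb hvb).symm)
  · intro h
    by_contra hχ
    refine h ⟨u, Finsupp.mem_support_iff.mp hu, fun u' hu' hne => ?_⟩
    rw [← Finsupp.mem_support_iff] at hu'
    exact hmin ▸ (tropPoly_le hu').lt_of_ne fun e =>
      hχ ⟨u, hu, u', hu', hne.symm, hmin.symm, e.symm⟩

theorem notMem_tropField_iff [AddGroup.FG H] {J : Ideal K[H]} :
    χ ∉ tropField v J ↔ ∃ f ∈ J, HasUniqueMin (tropTerm v f χ) f := by
  obtain ⟨n, ψ, hψ⟩ := AddSubgroup.fg_iff_exists_fin_addMonoidHom.mp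
    (AddGroup.fg_def.mp ‹AddGroup.FG H›)
  have hψ_surj := AddMonoidHom.range_eq_top.mp hψ
  rw [tropField_eq v ψ hψ_surj, Set.mem_ofPred_eq, comp_mem_tropLaurent_iff v ψ hψ_surj]
  push Not
  refine exists_congr fun f => and_congr_right fun _ => ⟨fun ⟨hf, hχ⟩ => ?_, fun h => ?_⟩
  · exact not_not.mp ((mem_tropHypersurface_iff hf).not.mp hχ)
  · have hf : f ≠ 0 := by
      rintro rfl
      exact h.elim fun m hm => hm.1 rfl
    exact ⟨hf, (mem_tropHypersurface_iff hf).not.mpr (not_not.mpr h)⟩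

theorem trivialVal_eq_zero {x : K} (hx : x ≠ 0) : trivialVal K x = 0 :=
  if_neg hx

theorem padicVal_eq {p : Nat.Primes} {x : ℚ} (hx : x ≠ 0) :
    padicVal p x = ((padicValRat p x : ℝ) : WithTop ℝ) :=
  if_neg hx

theorem notMem_tropField_trivialVal_iff [AddGroup.FG H] {J : Ideal K[H]} :
    χ ∉ tropField (trivialVal K) J ↔ ∃ f ∈ J, HasUniqueMin χ f := by
  rw [notMem_tropField_iff]
  refine exists_congr fun f => and_congr_right fun _ => exists_congr fun m =>
    and_congr_right fun hm => forall₂_congr fun m' hm' => ?_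
  rw [tropTerm, tropTerm, trivialVal_eq_zero hm, trivialVal_eq_zero hm', zero_add, zero_add,
    WithTop.coe_lt_coe]

end TropField

section ExtendIdeal

open AddMonoidAlgebra

/-- Every element of `K` is a quotient of integers, that is, `K` is its own prime field. -/
def IsPrimeField (K : Type*) [Field K] : Prop :=
  ∀ x : K, ∃ n a : ℤ, (n : K) ≠ 0 ∧ n * x = a

theorem isPrimeField_rat : IsPrimeField ℚ := fun x =>
  ⟨x.den, x.num, by exact_mod_cast x.den_nz, by exact_mod_cast x.den_mul_eq_num⟩

theorem isPrimeField_zmod (p : ℕ) [Fact p.Prime] : IsPrimeField (ZMod p) := fun x =>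
  let ⟨a, ha⟩ := ZMod.intCast_surjective x
  ⟨1, a, by simp, by simp [ha]⟩

variable {K H : Type*} [Field K] [AddCommGroup H] {I : Ideal ℤ[H]} {χ : H →+ ℝ}

theorem exists_intCast_coeff_eq_of_mem_extendIdeal (hK : IsPrimeField K) {f : K[H]}
    (hf : f ∈ extendIdeal K I) :
    ∃ n : ℤ, (n : K) ≠ 0 ∧ ∃ F ∈ I, ∀ h, (F.coeff h : K) = n * f.coeff h := by
  have add_closed {f g : K[H]}
      (hf : ∃ n : ℤ, (n : K) ≠ 0 ∧ ∃ F ∈ I, ∀ h, (F.coeff h : K) = n * f.coeff h)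
      (hg : ∃ n : ℤ, (n : K) ≠ 0 ∧ ∃ F ∈ I, ∀ h, (F.coeff h : K) = n * g.coeff h) :
      ∃ n : ℤ, (n : K) ≠ 0 ∧ ∃ F ∈ I, ∀ h, (F.coeff h : K) = n * (f + g).coeff h := by
    obtain ⟨n, hn, F, hF, hFf⟩ := hf
    obtain ⟨m, hm, G, hG, hGg⟩ := hg
    refine ⟨n * m, by exact_mod_cast mul_ne_zero hn hm, m • F + n • G,
      I.add_mem (I.smul_of_tower_mem m hF) (I.smul_of_tower_mem n hG), fun h => ?_⟩
    simp only [coeff_add, coeff_smul, Finsupp.add_apply, Finsupp.smul_apply, smul_eq_mul,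
      Int.cast_add, Int.cast_mul, hFf, hGg]
    ring
  have zero_closed :
      ∃ n : ℤ, (n : K) ≠ 0 ∧ ∃ F ∈ I, ∀ h, (F.coeff h : K) = n * (0 : K[H]).coeff h :=
    ⟨1, by simp, 0, I.zero_mem, by simp⟩
  induction hf using Submodule.span_induction with
  | zero => exact zero_closed
  | mem f hf =>
    obtain ⟨F, hF, rfl⟩ := hf
    exact ⟨1, by simp, F, hF, by simp⟩
  | add f g _ _ hf hg => exact add_closed hf hg
  | smul a f _ hf =>
    induction a using AddMonoidAlgebra.induction_linear with
    | zero => exact (zero_smul K[H] f).symm ▸ zero_closed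
    | add a b ha hb => exact (add_smul a b f).symm ▸ add_closed ha hb
    | single g r =>
      obtain ⟨n, hn, F, hF, hFf⟩ := hf
      obtain ⟨m, b, hm, hb⟩ := hK r
      refine ⟨m * n, by exact_mod_cast mul_ne_zero hm hn, single g b * F, I.mul_mem_left _ hF,
        fun h => ?_⟩
      rw [smul_eq_mul, coeff_single_mul_apply, coeff_single_mul_apply, Int.cast_mul, hFf, ← hb,
        Int.cast_mul]
      ring

variable [AddGroup.FG H] {v : AddValuation K (WithTop ℝ)}

theorem notMem_tropField_extendIdeal {F : ℤ[H]} (hF : F ∈ I) {m : H} (hm : (F.coeff m : K) ≠ 0)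
    (hlt : ∀ m', (F.coeff m' : K) ≠ 0 → m' ≠ m →
      v (F.coeff m) + (χ m : WithTop ℝ) < v (F.coeff m') + (χ m' : WithTop ℝ)) :
    χ ∉ tropField v (extendIdeal K I) :=
  notMem_tropField_iff.mpr ⟨_, Ideal.mem_map_of_mem _ hF, m, hm, hlt⟩

theorem notMem_tropField_extendIdeal_iff (hK : IsPrimeField K) :
    χ ∉ tropField v (extendIdeal K I) ↔
      ∃ F ∈ I, ∃ m, (F.coeff m : K) ≠ 0 ∧ ∀ m', (F.coeff m' : K) ≠ 0 → m' ≠ m →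
        v (F.coeff m) + (χ m : WithTop ℝ) < v (F.coeff m') + (χ m' : WithTop ℝ) := by
  refine ⟨fun h => ?_, fun ⟨F, hF, m, hm, hlt⟩ => notMem_tropField_extendIdeal hF hm hlt⟩
  obtain ⟨f, hf, m, hm, hlt⟩ := notMem_tropField_iff.mp h
  obtain ⟨n, hn, F, hF, hFf⟩ := exists_intCast_coeff_eq_of_mem_extendIdeal hK hf
  refine ⟨F, hF, m, by simp [hFf, hn, hm], fun m' hm' hne => ?_⟩
  rw [hFf, v.map_mul, hFf, v.map_mul, add_assoc, add_assoc]
  exact WithTop.add_lt_add_left (v.ne_top_iff.mpr hn)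
    (hlt m' (right_ne_zero_of_mul (hFf m' ▸ hm')) hne)

end ExtendIdeal

section TropUnion

open AddMonoidAlgebra

variable {K H : Type*} [Field K] [AddCommGroup H] [AddGroup.FG H] {I : Ideal ℤ[H]} {χ : H →+ ℝ}
  {v : AddValuation K (WithTop ℝ)}

theorem zero_le_map_intCast {K : Type*} [Field K] (v : AddValuation K (WithTop ℝ)) (n : ℤ) :
    0 ≤ v n :=
  intCast_mem (AddValuation.toValuation v).integer n

theorem notMem_tropField_extendIdeal_of_map_coeff_eq_zero {F : ℤ[H]} (hF : F ∈ I) {m : H}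
    (hm : v (F.coeff m) = 0) (hmin : ∀ m', F.coeff m' ≠ 0 → m' ≠ m → χ m < χ m') :
    χ ∉ tropField v (extendIdeal K I) := by
  refine notMem_tropField_extendIdeal hF (v.ne_top_iff.mp (hm.trans_ne WithTop.zero_ne_top))
    fun m' hm' hne => ?_
  have hlt := hmin m' (fun h => hm' (by rw [h, Int.cast_zero])) hne
  calc v (F.coeff m) + (χ m : WithTop ℝ) = (χ m : WithTop ℝ) := by rw [hm, zero_add]
    _ < (χ m' : WithTop ℝ) := WithTop.coe_lt_coe.mpr hlt
    _ ≤ v (F.coeff m') + (χ m' : WithTop ℝ) := le_add_of_nonneg_left (zero_le_map_intCast v _)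

theorem tropField_extendIdeal_subset_tropRing (v : AddValuation K (WithTop ℝ)) (I : Ideal ℤ[H]) :
    tropField v (extendIdeal K I) ⊆ tropRing I := by
  intro χ
  contrapose
  intro hχ
  obtain ⟨f, hf, hf1⟩ := notMem_tropRing_iff.mp hχ
  have coeff_sub (h : H) : (f - 1).coeff h = f.coeff h - Finsupp.single 0 1 h := by
    rw [coeff_sub, one_def, coeff_single, Finsupp.sub_apply]
  refine notMem_tropField_extendIdeal_of_map_coeff_eq_zero hf (m := 0) ?_ fun h hh h0 => ?_
  · have := mem_supported'.mp hf1 0 (by simp)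
    rw [coeff_sub, Finsupp.single_eq_same, sub_eq_zero] at this
    rw [this, Int.cast_one, v.map_one]
  · by_contra hχ
    rw [map_zero] at hχ
    have := mem_supported'.mp hf1 h hχ
    rw [coeff_sub, Finsupp.single_eq_of_ne h0, sub_zero] at this
    exact hh this

theorem tropUnion_subset_tropRing (I : Ideal ℤ[H]) (P : Set Nat.Primes) :
    tropUnion I P ⊆ tropRing I :=
  Set.union_subset (tropField_extendIdeal_subset_tropRing _ I) <| Set.iUnion₂_subset fun _ _ =>
    Set.union_subset (tropField_extendIdeal_subset_tropRing _ I)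
      (tropField_extendIdeal_subset_tropRing _ I)

theorem notMem_tropField_trivialVal_extendIdeal_rat_iff :
    χ ∉ tropField (trivialVal ℚ) (extendIdeal ℚ I) ↔ ∃ F ∈ I, HasUniqueMin χ F := by
  rw [notMem_tropField_extendIdeal_iff isPrimeField_rat]
  refine exists_congr fun F => and_congr_right fun _ => exists_congr fun m => ?_
  rw [Int.cast_ne_zero]
  refine and_congr_right fun hm => forall_congr' fun m' => ?_
  rw [Int.cast_ne_zero]
  refine imp_congr_right fun hm' => ?_
  rw [trivialVal_eq_zero (Int.cast_ne_zero.mpr hm), trivialVal_eq_zero (Int.cast_ne_zero.mpr hm'),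
    zero_add, zero_add, WithTop.coe_lt_coe]

theorem exists_finset_forall_hasUniqueMin_int (I : Ideal ℤ[H]) :
    ∃ B : Finset I, ∀ χ : H →+ ℝ, (∃ F ∈ I, HasUniqueMin χ F) →
      ∃ F ∈ B, HasUniqueMin χ (F : ℤ[H]) := by
  classical
  obtain ⟨B, hB⟩ := exists_finset_forall_hasUniqueMin (Γ := ℝ) (extendIdeal ℚ I)
  choose n hn F hF hFf using fun f : extendIdeal ℚ I =>
    exists_intCast_coeff_eq_of_mem_extendIdeal isPrimeField_rat f.2
  refine ⟨B.image fun f => ⟨F f, hF f⟩, fun χ hχ => ?_⟩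
  rw [← notMem_tropField_trivialVal_extendIdeal_rat_iff, notMem_tropField_trivialVal_iff] at hχ
  obtain ⟨f, hf, m, hm, hlt⟩ := hB χ hχ
  have coeff_ne_zero_iff (h : H) : (F f).coeff h ≠ 0 ↔ (f : ℚ[H]).coeff h ≠ 0 := by
    rw [← Int.cast_ne_zero (α := ℚ), hFf, mul_ne_zero_iff, and_iff_right (hn f)]
  exact ⟨_, Finset.mem_image_of_mem _ hf, m, (coeff_ne_zero_iff m).mpr hm,
    fun m' hm' => hlt m' ((coeff_ne_zero_iff m').mp hm')⟩

theorem finite_setOf_dvd {a : ℤ} (ha : a ≠ 0) : {p : Nat.Primes | (p : ℤ) ∣ a}.Finite := by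
  refine Set.Finite.of_finite_image ?_ Subtype.val_injective.injOn
  refine a.natAbs.divisors.finite_toSet.subset ?_
  rintro _ ⟨p, hp, rfl⟩
  exact Nat.mem_divisors.mpr ⟨Int.natCast_dvd.mp hp, Int.natAbs_ne_zero.mpr ha⟩

theorem exists_finite_tropUnion_eq (I : Ideal ℤ[H]) :
    ∃ P : Set Nat.Primes, P.Finite ∧ tropUnion I P = tropUnion I Set.univ := by
  obtain ⟨B, hB⟩ := exists_finset_forall_hasUniqueMin_int I
  let P : Set Nat.Primes :=
    ⋃ F ∈ B, ⋃ m ∈ (F : ℤ[H]).coeff.support, {p | (p : ℤ) ∣ (F : ℤ[H]).coeff m}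
  have hP : P.Finite := B.finite_toSet.biUnion fun F _ => Set.Finite.biUnion (Finset.finite_toSet _)
    fun m hm => finite_setOf_dvd (Finsupp.mem_support_iff.mp hm)
  refine ⟨P, hP, subset_antisymm ?_ ?_⟩
  · exact Set.union_subset_union_right _ (Set.biUnion_subset_biUnion_left (Set.subset_univ P))
  intro χ hχ
  by_contra hχP
  have hχ₀ : χ ∉ tropField (trivialVal ℚ) (extendIdeal ℚ I) := fun h => hχP (Or.inl h)
  obtain ⟨F, hF, m, hm, hmin⟩ := hB χ (notMem_tropField_trivialVal_extendIdeal_rat_iff.mp hχ₀)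
  obtain ⟨p, -, hp⟩ := Set.mem_iUnion₂.mp (hχ.resolve_left hχ₀)
  have hpm : ¬ (p : ℤ) ∣ (F : ℤ[H]).coeff m := fun hdvd => hχP <| Or.inr <|
    Set.mem_iUnion₂.mpr ⟨p, Set.mem_biUnion hF <|
      Set.mem_biUnion (Finset.mem_coe.mpr (Finsupp.mem_support_iff.mpr hm)) hdvd, hp⟩
  obtain hp | hp := hp
  · refine notMem_tropField_extendIdeal_of_map_coeff_eq_zero F.2 ?_ hmin hp
    rw [padicVal_eq (Int.cast_ne_zero.mpr hm), padicValRat.of_int,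
      padicValInt.eq_zero_of_not_dvd hpm]
    simp
  · refine notMem_tropField_extendIdeal_of_map_coeff_eq_zero F.2 ?_ hmin hp
    exact trivialVal_eq_zero fun h => hpm ((ZMod.intCast_zmod_eq_zero_iff_dvd _ p).mp h)

end TropUnion

/-! ### Valuations adapted to a character -/

section Valuation

open AddMonoidAlgebra

universe u v

theorem exists_valuation_of_comap_sup_ne_top {A : Type u} {B : Type*} [CommRing A] [CommRing B]
    (φ : B →+* A) {I : Ideal A} {J : Ideal B} (hIJ : I.comap φ ⊔ J ≠ ⊤) :
    ∃ (Γ₀ : Type u) (_ : LinearOrderedCommGroupWithZero Γ₀) (w : Valuation A Γ₀),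
      I ≤ w.supp ∧ (∀ b, w (φ b) ≤ 1) ∧ ∀ b ∈ J, w (φ b) < 1 := by
  have disjoint : Disjoint (I : Set A) ((MonoidHom.mker (Ideal.Quotient.mk J)).map φ) := by
    rw [Set.disjoint_left]
    rintro _ hb ⟨b, hb1, rfl⟩
    refine hIJ ((Ideal.eq_top_iff_one _).mpr ?_)
    rw [← add_sub_cancel b 1]
    exact Submodule.add_mem_sup hb (Ideal.Quotient.mk_eq_mk_iff_sub_mem 1 b |>.mp hb1.symm)
  obtain ⟨P, hP, hIP, hPdisj⟩ := Ideal.exists_le_prime_disjoint I _ disjoint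
  let π : A →+* FractionRing (A ⧸ P) := (algebraMap _ _).comp (Ideal.Quotient.mk P)
  have π_eq_zero_iff (a : A) : π a = 0 ↔ a ∈ P := by
    rw [RingHom.comp_apply, FaithfulSMul.algebraMap_eq_zero_iff, Ideal.Quotient.eq_zero_iff_mem]
  let ρ := (π.comp φ).rangeRestrict
  have map_ne_top : J.map ρ ≠ ⊤ := by
    rw [Ne, Ideal.eq_top_iff_one, Ideal.mem_map_iff_of_surjective ρ
      (π.comp φ).rangeRestrict_surjective]
    rintro ⟨b, hb, hb1⟩
    have mem_P : φ (1 - b) ∈ P := by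
      rw [← π_eq_zero_iff, map_sub, map_sub, map_one, map_one, sub_eq_zero]
      exact (congrArg Subtype.val hb1).symm
    refine Set.disjoint_left.mp hPdisj mem_P ⟨1 - b, MonoidHom.mem_mker.mpr ?_, rfl⟩
    rw [map_sub, Ideal.Quotient.eq_zero_iff_mem.mpr hb, map_one, sub_zero]
  obtain ⟨V, hV, hJV⟩ := Ideal.image_subset_nonunits_valuationSubring _ map_ne_top
  refine ⟨_, _, V.valuation.comap π, fun a ha => ?_, fun b => ?_, fun b hb => ?_⟩
  · rw [Valuation.mem_supp_iff, Valuation.comap_apply, (π_eq_zero_iff a).mpr (hIP ha), map_zero]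
  · exact (V.valuation_le_one_iff _).mpr (hV ⟨b, rfl⟩)
  · exact V.mem_nonunits_iff.mp (hJV ⟨ρ b, Ideal.mem_map_of_mem ρ hb, rfl⟩)

variable {Γ₀ : Type*} [LinearOrderedCommGroupWithZero Γ₀]

section IntegerValues

variable {A : Type*} [CommRing A] (w : Valuation A Γ₀)

theorem map_intCast_le_one (a : ℤ) : w a ≤ 1 :=
  intCast_mem w.integer a

variable {w}

theorem map_intCast_eq_one_of_not_dvd {p : Nat.Primes} (hp : w (p : ℤ) < 1) {a : ℤ}
    (ha : ¬ (p : ℤ) ∣ a) : w a = 1 := by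
  obtain ⟨x, y, hxy⟩ := (Prime.coprime_iff_not_dvd (Nat.prime_iff_prime_int.mp p.2)).mpr ha
  refine (map_intCast_le_one w a).antisymm (not_lt.mp fun hlt => ?_)
  have hlt_one : w (x * (p : ℤ) + y * a) < 1 := by
    refine w.map_add_lt ?_ ?_ <;> rw [map_mul]
    · exact (mul_le_of_le_one_left' (map_intCast_le_one w x)).trans_lt hp
    · exact (mul_le_of_le_one_left' (map_intCast_le_one w y)).trans_lt hlt
  rw [← Int.cast_mul, ← Int.cast_mul, ← Int.cast_add, hxy, Int.cast_one, map_one] at hlt_one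
  exact lt_irrefl _ hlt_one

theorem map_intCast_eq_one_of_forall_prime (h : ∀ p : Nat.Primes, w (p : ℤ) = 1) {a : ℤ}
    (ha : a ≠ 0) : w a = 1 := by
  have map_natCast_eq_one (n : ℕ) (hn : n ≠ 0) : w (n : ℤ) = 1 := by
    induction n using induction_on_primes with
    | zero => exact absurd rfl hn
    | one => rw [Nat.cast_one, Int.cast_one, map_one]
    | prime_mul p n hp ih =>
      rw [Nat.cast_mul, Int.cast_mul, map_mul, ih (right_ne_zero_of_mul hn), mul_one]
      exact h ⟨p, hp⟩
  obtain hn | hn := Int.natAbs_eq a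
  · rw [hn, map_natCast_eq_one _ (Int.natAbs_ne_zero.mpr ha)]
  · rw [hn, Int.cast_neg, w.map_neg, map_natCast_eq_one _ (Int.natAbs_ne_zero.mpr ha)]

variable (w)

theorem exists_prime_forall_map_intCast_eq_pow :
    ∃ p : Nat.Primes, ∀ a : ℤ, a ≠ 0 → w a = w (p : ℤ) ^ padicValInt p a := by
  by_cases h : ∃ p : Nat.Primes, w (p : ℤ) < 1
  · obtain ⟨p, hp⟩ := h
    refine ⟨p, fun a ha => ?_⟩
    obtain ⟨b, hb⟩ := padicValInt_dvd (p := p) a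
    have hpb : ¬ (p : ℤ) ∣ b := by
      rintro ⟨d, rfl⟩
      have hdvd : (p : ℤ) ^ (padicValInt p a + 1) ∣ a := ⟨d, by rw [pow_succ, mul_assoc, ← hb]⟩
      exact Nat.not_succ_le_self _ (((padicValInt_dvd_iff _ a).mp hdvd).resolve_left ha)
    conv_lhs => rw [hb]
    rw [Int.cast_mul, map_mul, map_intCast_eq_one_of_not_dvd hp hpb, mul_one, Int.cast_pow, map_pow]
  · push Not at h
    have h_one (p : Nat.Primes) : w (p : ℤ) = 1 := (map_intCast_le_one w _).antisymm (h p)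
    exact ⟨⟨2, Nat.prime_two⟩, fun a ha => by
      rw [map_intCast_eq_one_of_forall_prime h_one ha, h_one ⟨2, _⟩, one_pow]⟩

end IntegerValues

section MonoidAlgebra

variable {R H : Type*} [CommRing R] [AddCommGroup H] {χ : H →+ ℝ} {w : Valuation R[H] Γ₀}

theorem exists_ne_map_single_coeff_le {f : R[H]} (hf : f ∈ w.supp) {m : H}
    (hm : w (single m (f.coeff m)) ≠ 0) :
    ∃ m' ≠ m, w (single m (f.coeff m)) ≤ w (single m' (f.coeff m')) := by
  classical
  by_contra! hlt
  have hmem : m ∈ f.coeff.support := by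
    rw [Finsupp.mem_support_iff]
    intro h
    exact hm (by rw [h, single_zero, map_zero])
  have hsum := sum_coeff_single f
  rw [Finsupp.sum, ← Finset.sum_erase_add _ _ hmem] at hsum
  have hsum_lt := w.map_sum_lt (s := f.coeff.support.erase m) hm
    fun m' hm' => hlt m' (Finset.ne_of_mem_erase hm')
  refine hm ?_
  rw [← w.map_add_eq_of_lt_right hsum_lt, hsum, (w.mem_supp_iff f).mp hf]

theorem map_single_neg_one (w : Valuation R[H] Γ₀) (h : H) :
    w (single (-h) 1) = (w (single h 1))⁻¹ := by
  refine eq_inv_of_mul_eq_one_left ?_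
  rw [← map_mul, single_mul_single, neg_add_cancel, mul_one, ← one_def, map_one]

theorem map_single_one_pos (w : Valuation R[H] Γ₀) (h : H) : 0 < w (single h 1) := by
  refine zero_lt_iff.mpr fun h0 => one_ne_zero (α := Γ₀) ?_
  rw [← map_one w, one_def, ← add_neg_cancel h, ← mul_one (1 : R), ← single_mul_single, map_mul, h0,
    zero_mul]

theorem map_single_nsmul_one (w : Valuation R[H] Γ₀) (n : ℕ) (h : H) :
    w (single (n • h) 1) = w (single h 1) ^ n := by
  rw [← map_pow, single_pow, one_pow]

variable (χ w) in
/-- The valuation `w` of `R[H]` is *adapted* to the character `χ` if its ring contains the subring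
of `R[H]` of the elements of nonnegative `χ`-degree and its maximal ideal contains those of
positive degree. Since `w` is nonarchimedean, it suffices to say so for the terms `r h`. -/
structure IsAdaptedTo : Prop where
  map_single_le_one : ∀ {h : H} (r : R), 0 ≤ χ h → w (single h r) ≤ 1
  map_single_lt_one : ∀ {h : H} (r : R), 0 < χ h → w (single h r) < 1

namespace IsAdaptedTo

variable {g h : H} (hw : IsAdaptedTo χ w)
include hw

theorem map_single_le_of_le (r : R) (hgh : χ g ≤ χ h) : w (single h r) ≤ w (single g 1) := by
  rw [← add_sub_cancel g h, ← one_mul r, ← single_mul_single, map_mul]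
  exact mul_le_of_le_one_right' (hw.map_single_le_one r (by rwa [map_sub, sub_nonneg]))

theorem map_single_lt_of_lt (r : R) (hgh : χ g < χ h) : w (single h r) < w (single g 1) := by
  rw [← add_sub_cancel g h, ← one_mul r, ← single_mul_single, map_mul]
  exact mul_lt_of_lt_one_right (map_single_one_pos w g)
    (hw.map_single_lt_one r (by rwa [map_sub, sub_pos]))

theorem div_le_div_of_pow_le_of_le_pow {q : Γ₀} {b d : ℕ} (hb : 0 < b) (hd : 0 < d)
    (hg : q ^ b ≤ w (single g 1)) (hh : w (single h 1) ≤ q ^ d) : χ g / b ≤ χ h / d := by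
  rw [div_le_div_iff₀ (Nat.cast_pos.mpr hb) (Nat.cast_pos.mpr hd)]
  by_contra! hlt
  refine (hw.map_single_lt_of_lt (g := b • h) (h := d • g) 1 ?_).not_ge ?_
  · rwa [map_nsmul, map_nsmul, nsmul_eq_mul, nsmul_eq_mul, mul_comm, mul_comm (d : ℝ)]
  · calc w (single (b • h) 1) = w (single h 1) ^ b := map_single_nsmul_one w b h
      _ ≤ (q ^ d) ^ b := pow_le_pow_left₀ zero_le hh b
      _ = (q ^ b) ^ d := pow_right_comm q d b
      _ ≤ w (single g 1) ^ d := pow_le_pow_left₀ zero_le hg d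
      _ = w (single (d • g) 1) := (map_single_nsmul_one w d g).symm

theorem exists_slope {q : Γ₀} {h₀ : H} (hh₀ : 0 < χ h₀) {m n : ℕ}
    (hm : q ^ m ≤ w (single h₀ 1)) (hn : w (single h₀ 1) ^ n ≤ q) :
    ∃ t : ℝ, 0 < t ∧ (∀ (g : H) (b : ℕ), 0 < b → q ^ b ≤ w (single g 1) → χ g / b ≤ t) ∧
      ∀ (h : H) (d : ℕ), 0 < d → w (single h 1) ≤ q ^ d → t ≤ χ h / d := by
  have hm0 : 0 < m := Nat.pos_of_ne_zero fun h0 =>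
    hm.not_gt (by rw [h0, pow_zero]; exact hw.map_single_lt_one 1 hh₀)
  let lower : Set ℝ := {x | ∃ (g : H) (b : ℕ), 0 < b ∧ q ^ b ≤ w (single g 1) ∧ χ g / b = x}
  let upper : Set ℝ := {y | ∃ (h : H) (d : ℕ), 0 < d ∧ w (single h 1) ≤ q ^ d ∧ χ h / d = y}
  have lower_le_upper : ∀ x ∈ lower, ∀ y ∈ upper, x ≤ y := by
    rintro _ ⟨g, b, hb, hg, rfl⟩ _ ⟨h, d, hd, hh, rfl⟩
    exact hw.div_le_div_of_pow_le_of_le_pow hb hd hg hh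
  have hlower : χ h₀ / m ∈ lower := ⟨h₀, m, hm0, hm, rfl⟩
  have hupper : χ (n • h₀) / (1 : ℕ) ∈ upper :=
    ⟨n • h₀, 1, one_pos, by rwa [map_single_nsmul_one, pow_one], rfl⟩
  obtain ⟨t, ht_upper, ht_lower⟩ := exists_between_of_forall_le ⟨_, hlower⟩ ⟨_, hupper⟩
    lower_le_upper
  exact ⟨t, (div_pos hh₀ (Nat.cast_pos.mpr hm0)).trans_le (ht_upper hlower),
    fun g b hb hg => ht_upper ⟨g, b, hb, hg, rfl⟩, fun h d hd hh => ht_lower ⟨h, d, hd, hh, rfl⟩⟩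

theorem exists_pos_forall_map_single_lt_zpow {q : Γ₀} {h₀ : H} (hh₀ : 0 < χ h₀) {m n : ℕ}
    (hm : q ^ m ≤ w (single h₀ 1)) (hn : w (single h₀ 1) ^ n ≤ q) :
    ∃ c : ℝ, 0 < c ∧ ∀ (e : ℤ) (h : H), e < c * χ h → w (single h 1) < q ^ e := by
  have hq : 0 < q := (pow_pos (map_single_one_pos w h₀) n).trans_le hn
  obtain ⟨t, ht, le_t, t_le⟩ := hw.exists_slope hh₀ hm hn
  refine ⟨t⁻¹, inv_pos.mpr ht, fun e h he => ?_⟩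
  rw [lt_inv_mul_iff₀ ht] at he
  by_contra! hqh
  obtain he0 | rfl | he0 := lt_trichotomy e 0
  · obtain ⟨d, rfl⟩ := Int.exists_eq_neg_ofNat he0.le
    have hd : 0 < d := by exact_mod_cast neg_lt_zero.mp he0
    have hhd : w (single (-h) 1) ≤ q ^ d := by
      rw [map_single_neg_one]
      rw [zpow_neg, zpow_natCast] at hqh
      exact inv_le_of_inv_le₀ (pow_pos hq d) hqh
    have ht_le := t_le (-h) d hd hhd
    rw [le_div_iff₀ (Nat.cast_pos.mpr hd), map_neg] at ht_le
    push_cast at he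
    linarith
  · rw [zpow_zero] at hqh
    rw [Int.cast_zero, mul_zero] at he
    exact hqh.not_gt (hw.map_single_lt_one 1 he)
  · lift e to ℕ using he0.le
    rw [zpow_natCast] at hqh
    have ht_ge := le_t h e (Int.natCast_pos.mp he0) hqh
    rw [div_le_iff₀ (Nat.cast_pos.mpr (Int.natCast_pos.mp he0))] at ht_ge
    exact he.not_ge ht_ge

end IsAdaptedTo

theorem exists_isAdaptedTo_of_mem_tropRing {R : Type u} {H : Type v} [CommRing R]
    [AddCommGroup H] {I : Ideal R[H]} {χ : H →+ ℝ} (hχ : χ ∈ tropRing I) :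
    ∃ (Γ₀ : Type (max u v)) (_ : LinearOrderedCommGroupWithZero Γ₀) (w : Valuation R[H] Γ₀),
      I ≤ w.supp ∧ IsAdaptedTo χ w := by
  classical
  let S : AddSubmonoid H := (AddSubmonoid.nonneg ℝ).comap χ
  let φ : R[S] →+* R[H] := mapDomainRingHom R S.subtype
  let J : Ideal R[S] := Ideal.span (of' R S '' {s | 0 < χ (s : H)})
  have map_mem_supported {j : R[S]} (hj : j ∈ J) : φ j ∈ supported R R {h | 0 < χ h} := by
    rw [mem_supported']
    intro h hh
    refine Finsupp.notMem_support_iff.mp fun hmem => hh ?_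
    obtain ⟨s, hs, rfl⟩ := Finset.mem_image.mp (Finsupp.mapDomain_support hmem)
    obtain ⟨s', hs', d, rfl⟩ := mem_ideal_span_of'_image.mp hj s hs
    exact (add_pos_of_nonneg_of_pos d.2 hs').trans_eq (map_add χ (d : H) s').symm
  have comap_sup_ne_top : I.comap φ ⊔ J ≠ ⊤ := by
    intro htop
    obtain ⟨i, hi, j, hj, hij⟩ := Submodule.mem_sup.mp ((Ideal.eq_top_iff_one _).mp htop)
    refine notMem_tropRing_iff.mpr ⟨φ i, hi, ?_⟩ hχ
    rw [← map_one φ, ← hij, map_add, sub_add_cancel_left]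
    exact Submodule.neg_mem _ (map_mem_supported hj)
  obtain ⟨Γ₀, _, w, hI, hle, hlt⟩ := exists_valuation_of_comap_sup_ne_top φ comap_sup_ne_top
  have map_single (s : S) (r : R) : φ (single s r) = single (s : H) r := mapDomain_single
  refine ⟨Γ₀, _, w, hI, fun {h} r hh => ?_, fun {h} r hh => ?_⟩
  · exact map_single ⟨h, hh⟩ r ▸ hle _
  · refine map_single ⟨h, hh.le⟩ r ▸ hlt _ (mem_ideal_span_of'_image.mpr fun s hs => ?_)
    rw [Finset.mem_singleton.mp (Finsupp.support_single_subset hs)]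
    exact ⟨⟨h, hh.le⟩, hh, 0, (zero_add _).symm⟩

end MonoidAlgebra

end Valuation

section Integral

open AddMonoidAlgebra

variable {K H Γ₀ : Type*} [Field K] [AddCommGroup H] [LinearOrderedCommGroupWithZero Γ₀]
  {I : Ideal ℤ[H]} {χ : H →+ ℝ} {w : Valuation ℤ[H] Γ₀}

theorem map_single_int (w : Valuation ℤ[H] Γ₀) (h : H) (a : ℤ) :
    w (single h a) = w (single h 1) * w (a : ℤ[H]) := by
  rw [intCast_def, ← map_mul, single_mul_single, add_zero, one_mul, Int.cast_id]

theorem mem_tropField_extendIdeal_of_le_supp [AddGroup.FG H] (hK : IsPrimeField K)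
    {v : AddValuation K (WithTop ℝ)} (hI : I ≤ w.supp)
    (hw : ∀ (a b : ℤ) (h : H), (a : K) ≠ 0 → v a < v b + (χ h : WithTop ℝ) →
      w (single h b) < w (a : ℤ[H])) :
    χ ∈ tropField v (extendIdeal K I) := by
  by_contra hχ
  obtain ⟨F, hF, m, hm, hlt⟩ := (notMem_tropField_extendIdeal_iff hK).mp hχ
  have map_single_lt {m' : H} (hne : m' ≠ m) :
      w (single m' (F.coeff m')) < w (single m (F.coeff m)) := by
    have hlt' : v (F.coeff m) < v (F.coeff m') + (χ (m' - m) : WithTop ℝ) := by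
      obtain h0 | h0 := eq_or_ne (F.coeff m' : K) 0
      · rw [h0, v.map_zero, WithTop.top_add]
        exact (v.ne_top_iff.mpr hm).lt_top
      · refine lt_of_add_lt_add_right (a := (χ m : WithTop ℝ)) ?_
        rw [add_assoc, ← WithTop.coe_add, ← map_add, sub_add_cancel]
        exact hlt m' h0 hne
    rw [map_single_int w m, ← add_sub_cancel m m', ← one_mul (F.coeff (m + _)),
      ← single_mul_single, map_mul, add_sub_cancel]
    exact mul_lt_mul_of_pos_left (hw _ _ _ hm hlt') (map_single_one_pos w m)
  have map_single_ne_zero : w (single m (F.coeff m)) ≠ 0 := by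
    rw [map_single_int]
    have hpos := hw (F.coeff m) 0 0 hm (by
      rw [Int.cast_zero, v.map_zero, WithTop.top_add]
      exact (v.ne_top_iff.mpr hm).lt_top)
    exact mul_ne_zero (map_single_one_pos w m).ne' hpos.ne_zero
  obtain ⟨m', hne, hle⟩ := exists_ne_map_single_coeff_le (hI hF) map_single_ne_zero
  exact hle.not_gt (map_single_lt hne)

namespace IsAdaptedTo

variable [AddGroup.FG H] (hw : IsAdaptedTo χ w) (hI : I ≤ w.supp) {p : Nat.Primes} {h₀ : H}
include hw hI

theorem mem_tropField_trivialVal_rat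
    (hp : ∀ a : ℤ, a ≠ 0 → w (a : ℤ[H]) = w (p : ℤ) ^ padicValInt p a)
    (hlt : ∀ n : ℕ, w (single h₀ 1) < w (p : ℤ) ^ n) :
    χ ∈ tropField (trivialVal ℚ) (extendIdeal ℚ I) := by
  refine mem_tropField_extendIdeal_of_le_supp isPrimeField_rat hI fun a b h ha hab => ?_
  rw [Int.cast_ne_zero] at ha
  have hlt_a (n : ℕ) : w (single h₀ 1) < w (a : ℤ[H]) ^ n := by
    rw [hp a ha, ← pow_mul]
    exact hlt _
  obtain rfl | hb := eq_or_ne b 0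
  · rw [single_zero, map_zero, ← pow_one (w _)]
    exact zero_le.trans_lt (hlt_a 1)
  rw [trivialVal_eq_zero (Int.cast_ne_zero.mpr ha), trivialVal_eq_zero (Int.cast_ne_zero.mpr hb),
    zero_add, WithTop.coe_pos] at hab
  obtain ⟨n, hn⟩ := Archimedean.arch (χ h₀) hab
  refine lt_of_pow_lt_pow_left₀ n zero_le ?_
  calc w (single h b) ^ n = w (single (n • h) (b ^ n)) := by rw [← map_pow, single_pow]
    _ ≤ w (single h₀ 1) := hw.map_single_le_of_le _ (by rwa [map_nsmul])
    _ < w (a : ℤ[H]) ^ n := hlt_a n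

variable (hh₀ : 0 < χ h₀)
include hh₀

theorem mem_tropField_trivialVal_zmod
    (hp : ∀ a : ℤ, a ≠ 0 → w (a : ℤ[H]) = w (p : ℤ) ^ padicValInt p a)
    (hlt : ∀ n : ℕ, w (p : ℤ) < w (single h₀ 1) ^ n) :
    χ ∈ tropField (trivialVal (ZMod p)) (extendIdeal (ZMod p) I) := by
  refine mem_tropField_extendIdeal_of_le_supp (isPrimeField_zmod p) hI fun a b h ha hab => ?_
  have hpa : ¬ (p : ℤ) ∣ a := (ZMod.intCast_zmod_eq_zero_iff_dvd a p).not.mp ha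
  have map_a : w (a : ℤ[H]) = 1 := by
    rw [hp a fun h => hpa (h ▸ dvd_zero _), padicValInt.eq_zero_of_not_dvd hpa, pow_zero]
  rw [map_a]
  by_cases hpb : (p : ℤ) ∣ b
  · obtain ⟨c, rfl⟩ := hpb
    obtain ⟨n, hn⟩ := Archimedean.arch (-χ h) hh₀
    calc w (single h (p * c)) = w (single h c) * w (p : ℤ) := by
          rw [map_single_int, map_single_int w h c, Int.cast_mul, map_mul, mul_left_comm, mul_comm]
      _ ≤ w (single h 1) * w (p : ℤ) := mul_le_mul_left (hw.map_single_le_of_le c le_rfl) _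
      _ < w (single h 1) * w (single h₀ 1) ^ n :=
        mul_lt_mul_of_pos_left (hlt n) (map_single_one_pos w h)
      _ = w (single (h + n • h₀) 1) := by
        rw [← map_single_nsmul_one, ← map_mul, single_mul_single, one_mul]
      _ ≤ 1 := hw.map_single_le_one 1 (by rw [map_add, map_nsmul]; linarith)
  · rw [trivialVal_eq_zero ha, trivialVal_eq_zero
      ((ZMod.intCast_zmod_eq_zero_iff_dvd b p).not.mpr hpb), zero_add, WithTop.coe_pos] at hab
    exact hw.map_single_lt_one b hab

theorem exists_smul_mem_tropField_padicVal
    (hp : ∀ a : ℤ, a ≠ 0 → w (a : ℤ[H]) = w (p : ℤ) ^ padicValInt p a) {m n : ℕ}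
    (hm : w (p : ℤ) ^ m ≤ w (single h₀ 1)) (hn : w (single h₀ 1) ^ n ≤ w (p : ℤ)) :
    ∃ c : ℝ, 0 < c ∧ c • χ ∈ tropField (padicVal p) (extendIdeal ℚ I) := by
  obtain ⟨c, hc, lt_zpow⟩ := hw.exists_pos_forall_map_single_lt_zpow hh₀ hm hn
  have hq : 0 < w (p : ℤ) := (pow_pos (map_single_one_pos w h₀) n).trans_le hn
  refine ⟨c, hc, mem_tropField_extendIdeal_of_le_supp isPrimeField_rat hI fun a b h ha hab => ?_⟩
  rw [Int.cast_ne_zero] at ha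
  rw [hp a ha]
  obtain rfl | hb := eq_or_ne b 0
  · rw [single_zero, map_zero]
    exact pow_pos hq _
  rw [padicVal_eq (Int.cast_ne_zero.mpr ha), padicVal_eq (Int.cast_ne_zero.mpr hb),
    padicValRat.of_int, padicValRat.of_int, ← WithTop.coe_add, WithTop.coe_lt_coe] at hab
  have hlt := lt_zpow (padicValInt p a - padicValInt p b) h (by
    push_cast at hab ⊢
    exact sub_left_lt_of_lt_add hab)
  rw [zpow_sub₀ hq.ne', zpow_natCast, zpow_natCast, lt_div_iff₀ (pow_pos hq _)] at hlt
  rwa [map_single_int, hp b hb]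

end IsAdaptedTo

theorem exists_smul_mem_tropUnion [AddGroup.FG H] (hχ : χ ∈ tropRing I) (hχ0 : χ ≠ 0) :
    ∃ c : ℝ, 0 < c ∧ c • χ ∈ tropUnion I Set.univ := by
  obtain ⟨Γ₀, _, w, hI, hw⟩ := exists_isAdaptedTo_of_mem_tropRing hχ
  obtain ⟨p, hp⟩ := exists_prime_forall_map_intCast_eq_pow w
  obtain ⟨h₀, hh₀⟩ : ∃ h₀, 0 < χ h₀ := by
    obtain ⟨h, hh⟩ := DFunLike.ne_iff.mp hχ0
    obtain hneg | hpos := lt_or_gt_of_ne hh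
    · exact ⟨-h, by rw [map_neg]; exact neg_pos.mpr hneg⟩
    · exact ⟨h, hpos⟩
  have tropField_subset : tropField (padicVal p) (extendIdeal ℚ I) ∪
      tropField (trivialVal (ZMod p)) (extendIdeal (ZMod p) I) ⊆ tropUnion I Set.univ :=
    fun χ hχ => Or.inr (Set.mem_iUnion₂.mpr ⟨p, Set.mem_univ p, hχ⟩)
  by_cases h_rat : ∀ n : ℕ, w (single h₀ 1) < w (p : ℤ) ^ n
  · refine ⟨1, one_pos, Or.inl ?_⟩
    rw [one_smul]
    exact hw.mem_tropField_trivialVal_rat hI hp h_rat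
  by_cases h_zmod : ∀ n : ℕ, w (p : ℤ) < w (single h₀ 1) ^ n
  · refine ⟨1, one_pos, tropField_subset (Or.inr ?_)⟩
    rw [one_smul]
    exact hw.mem_tropField_trivialVal_zmod hI hh₀ hp h_zmod
  push Not at h_rat h_zmod
  obtain ⟨m, hm⟩ := h_rat
  obtain ⟨n, hn⟩ := h_zmod
  obtain ⟨c, hc, hcχ⟩ := hw.exists_smul_mem_tropField_padicVal hI hh₀ hp hm hn
  exact ⟨c, hc, tropField_subset (Or.inl hcχ)⟩

end Integral

theorem sphereProj_subset_sphereProj {H : Type*} [AddCommGroup H] {Z Z' : Set (H →+ ℝ)}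
    (h : ∀ χ ∈ Z, χ ≠ 0 → ∃ c : ℝ, 0 < c ∧ c • χ ∈ Z') : sphereProj Z ⊆ sphereProj Z' := by
  rintro _ ⟨χ, hχ0, hχ, rfl⟩
  obtain ⟨c, hc, hcχ⟩ := h χ hχ hχ0
  exact ⟨c • χ, smul_ne_zero hc.ne' hχ0, hcχ,
    (ray_eq_iff _ _).mpr (SameRay.sameRay_pos_smul_left χ hc)⟩

theorem sphereProj_mono {H : Type*} [AddCommGroup H] {Z Z' : Set (H →+ ℝ)} (h : Z ⊆ Z') :
    sphereProj Z ⊆ sphereProj Z' :=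
  sphereProj_subset_sphereProj fun χ hχ _ => ⟨1, one_pos, (one_smul ℝ χ).symm ▸ h hχ⟩

end

theorem mainTheorem7 {H : Type*} [AddCommGroup H] [AddGroup.FG H]
    (I : Ideal (AddMonoidAlgebra ℤ H)) :
    sphereProj (tropRing I) = sphereProj (tropUnion I Set.univ) ∧
      ∃ P : Set Nat.Primes, P.Finite ∧
        sphereProj (tropRing I) = sphereProj (tropUnion I P) := by
  have h_univ : sphereProj (tropRing I) = sphereProj (tropUnion I Set.univ) :=
    (sphereProj_subset_sphereProj fun _ hχ hχ0 => exists_smul_mem_tropUnion hχ hχ0).antisymm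
      (sphereProj_mono (tropUnion_subset_tropRing I Set.univ))
  obtain ⟨P, hP, hPI⟩ := exists_finite_tropUnion_eq I
  exact ⟨h_univ, P, hP, hPI ▸ h_univ⟩
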